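/- **Setting.** Let $\underline k\le\bar k$, $\underline u\le\bar u$, and let $k,u_0:\mathbb R\to\mathbb R$ have bounded variation on $\mathbb R$ (i.e. each agrees a.e. with a function of finite total variation), with $k(x)\in[\underline k,\bar k]$ and $u_0(x)\in[\underline u,\bar u]$ for a.e. $x$. Let $f=f(k,u)$ be a flux on $[\underline k,\bar k]\times[\underline u,\bar u]$ such that - for each $k$, $f(k,\cdot)\in C^3[\underline u,\bar u]$ is strictly convex, and $0<\gamma_1\le f_{uu}(k,u)\le\gamma_2$ for all $(k,u)$; - for each $u$, $f(\cdot,u)\in C^2[\underline k,\bar k]$ with $f_{kk}\equiv 0$, and $f_u(\cdot,u)\in C^1[\underline k,\bar k]$; - $f(k_1,\bar u)=f(k_2,\bar u)$ and $f(k_1,\underline u)=f(k_2,\underline u)$ for all $k_1,k_2\in[\underline k,\bar k]$. **Scheme.** Fix $\lambda>0$. For $\Delta x>0$ put $\Delta t=\lambda\Delta x$ and $x_p=p\,\Delta x$. At time level $n$ the grid points are the $x_p$ with $p+\frac n2\in\mathbb Z$. For such $p$ and also for the midpoints, let $k_p=\frac1{\Delta x}\int_{x_{p-1/2}}^{x_{p+1/2}}k\,dx$.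 Set $u^0_j=\frac1{\Delta x}\int_{x_{j-1/2}}^{x_{j+1/2}}u_0\,dx$ and $$u^{n+1}_{j+\frac12}=\tfrac12(u^n_j+u^n_{j+1})-\tfrac18(\sigma^n_{j+1}-\sigma^n_j)-\lambda\big(f(k_{j+1},u^{n+\frac12}_{j+1})-f(k_j,u^{n+\frac12}_j)\big),$$ $$u^{n+\frac12}_j=u^n_j-\tfrac\lambda2 f_u(k_j,u^n_j)\sigma^n_j,\qquad \sigma^n_j=\mathrm{minmod}\big(u^n_{j+1}-u^n_j,\ \tfrac12(u^n_{j+1}-u^n_{j-1}),\ u^n_j-u^n_{j-1}\big),$$ where $j+\frac n2\in\mathbb Z$; $\mathrm{minmod}$ of several numbers is the one of least absolute value if all have the same sign, and $0$ otherwise. Write $\Delta v_{j+\frac12}=v_{j+1}-v_j$, $\beta^n_{j+\frac12}=\lambda f_u\big(\tfrac{k_j+k_{j+1}}2,\tfrac{u^n_j+u^n_{j+1}}2\big)$, and $$\nu^n_{j+\frac12}=\tfrac18\big(1-4(\beta^n_{j+\frac12})^2\big)\Big[1-\tfrac1{16}\big(1-4(\beta^n_{j+\frac12})^2\big)\Big(\tfrac{\Delta\sigma^n_{j+1/2}}{\Delta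 u^n_{j+1/2}}\Big)^2-\beta^n_{j+\frac12}\tfrac{\Delta\sigma^n_{j+1/2}}{\Delta u^n_{j+1/2}}-\tfrac{\sigma^n_{j+1}+\sigma^n_j}{2\Delta u^n_{j+1/2}}\Big]f_{uu}\big(k_{j+\frac12},\tfrac{u^n_j+u^n_{j+1}}2\big),$$ the quotients being read as $0$ when $\Delta u^n_{j+1/2}=0$ (then $\sigma^n_j=\sigma^n_{j+1}=0$). **CFL condition.** With $C=\max\{|\underline u|,|\bar u|\}$, $\chi=228+13C+174C\gamma_2+12C^2\gamma_2$ and $\|f_u\|=\sup_{[\underline k,\bar k]\times[\underline u,\bar u]}|f_u|$, assume for some real $\kappa$ $$\lambda\|f_u\|\le\kappa\le\min\Big\{\frac{\gamma_1}{7500\gamma_2},\ \frac1{4000},\ \frac7{85+16C},\ \frac{\gamma_1}{\gamma_2\chi}\Big\}.$$ **Claim.** (i) $\nu^n_{j+\frac12}\ge0$ for every $\Delta x>0$, every $n\ge0$ and every $j$ with $j+\frac n2\in\mathbb Z$. (ii) For every $T>0$ and every $\Delta_0>0$ there is a constant $K$, independent of $\Delta x$, such that for all $\Delta x\in(0,\Delta_0]$,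 with $N=\lfloor T/\Delta t\rfloor+1$, the inner sums converge and $$\Delta x\sum_{n=0}^{N-1}\ \sum_{j+\frac n2\in\mathbb Z}\nu^n_{j+\frac12}\,(\Delta u^n_{j+\frac12})^2\le K.$$ By (i), the same $K$ bounds the local sums restricted to $|j|\le J=\lfloor X/\Delta x\rfloor+1$, for every $X>0$. -/

import Mathlib

open MeasureTheory Set

noncomputable section

namespace NTScheme

/-- `w` has bounded variation on `ℝ` (as an a.e. class): it agrees almost everywhere with a
function of finite pointwise total variation. No integrability of `w` over `ℝ` is required. -/
def HasBV (w : ℝ → ℝ) : Prop :=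
  ∃ v : ℝ → ℝ, w =ᵐ[volume] v ∧ BoundedVariationOn v univ

/-- The partial derivative `f_u(k, u)` of a flux given on `[uMin, uMax]` (one-sided at the
endpoints). -/
def fluxU (f : ℝ → ℝ → ℝ) (uMin uMax : ℝ) (k u : ℝ) : ℝ :=
  derivWithin (f k) (Icc uMin uMax) u

/-- The second partial derivative `f_uu(k, u)` (one-sided at the endpoints). -/
def fluxUU (f : ℝ → ℝ → ℝ) (uMin uMax : ℝ) (k u : ℝ) : ℝ :=
  iteratedDerivWithin 2 (f k) (Icc uMin uMax) u

/-- The standing hypotheses on the flux `f` over the rectangle `[kMin, kMax] × [uMin, uMax]`. -/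
structure FluxHyp (f : ℝ → ℝ → ℝ) (kMin kMax uMin uMax γ₁ γ₂ : ℝ) : Prop where
  smooth_u : ∀ k ∈ Icc kMin kMax, ContDiffOn ℝ 3 (f k) (Icc uMin uMax)
  strictConvex : ∀ k ∈ Icc kMin kMax, StrictConvexOn ℝ (Icc uMin uMax) (f k)
  gamma_pos : 0 < γ₁
  fuu_bounds : ∀ k ∈ Icc kMin kMax, ∀ u ∈ Icc uMin uMax,
    γ₁ ≤ fluxUU f uMin uMax k u ∧ fluxUU f uMin uMax k u ≤ γ₂
  smooth_k : ∀ u ∈ Icc uMin uMax, ContDiffOn ℝ 2 (fun k => f k u) (Icc kMin kMax)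
  fkk_zero : ∀ u ∈ Icc uMin uMax, ∀ k ∈ Icc kMin kMax,
    iteratedDerivWithin 2 (fun k' => f k' u) (Icc kMin kMax) k = 0
  smooth_fu_k : ∀ u ∈ Icc uMin uMax,
    ContDiffOn ℝ 1 (fun k => fluxU f uMin uMax k u) (Icc kMin kMax)
  eq_at_max : ∀ k₁ ∈ Icc kMin kMax, ∀ k₂ ∈ Icc kMin kMax, f k₁ uMax = f k₂ uMax
  eq_at_min : ∀ k₁ ∈ Icc kMin kMax, ∀ k₂ ∈ Icc kMin kMax, f k₁ uMin = f k₂ uMin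

/-- `C_{u₀} = max(|uMin|, |uMax|)`. -/
def supBound (uMin uMax : ℝ) : ℝ := max |uMin| |uMax|

/-- `χ = 228 + 13 C + 174 C γ₂ + 12 C² γ₂`. -/
def chi (C γ₂ : ℝ) : ℝ := 228 + 13 * C + 174 * C * γ₂ + 12 * C ^ 2 * γ₂

/-- The CFL condition `lam ‖f_u‖ ≤ κ ≤ min {...}`, the norm being the supremum over the rectangle
`[kMin, kMax] × [uMin, uMax]`. -/
def CFL (f : ℝ → ℝ → ℝ) (kMin kMax uMin uMax γ₁ γ₂ lam κ : ℝ) : Prop :=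
  (∀ k ∈ Icc kMin kMax, ∀ u ∈ Icc uMin uMax, lam * |fluxU f uMin uMax k u| ≤ κ) ∧
  κ ≤ γ₁ / (7500 * γ₂) ∧
  κ ≤ 1 / 4000 ∧
  κ ≤ 7 / (85 + 16 * supBound uMin uMax) ∧
  κ ≤ γ₁ / (γ₂ * chi (supBound uMin uMax) γ₂)

/-- Three-argument minmod. -/
def minmod (a b c : ℝ) : ℝ :=
  if Real.sign a = Real.sign b ∧ Real.sign b = Real.sign c then
    Real.sign a * min |a| (min |b| |c|)
  else 0

/-- The mean of `w` over the cell of width `dx` centred at `p * dx`. -/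
def cellAvg (w : ℝ → ℝ) (dx p : ℝ) : ℝ :=
  (1 / dx) * ∫ x in ((p - 1 / 2) * dx)..((p + 1 / 2) * dx), w x

/-- The limited slopes `σ_j` of a grid function. -/
def slope (v : ℤ → ℝ) (j : ℤ) : ℝ :=
  minmod (v (j + 1) - v j) ((v (j + 1) - v (j - 1)) / 2) (v j - v (j - 1))

/-- Mid-time values `v_j - (lam / 2) f_u(kk_j, v_j) σ_j`, for coefficient values `kk`. -/
def midValue (f : ℝ → ℝ → ℝ) (uMin uMax lam : ℝ) (kk v : ℤ → ℝ) (j : ℤ) : ℝ :=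
  v j - lam / 2 * fluxU f uMin uMax (kk j) (v j) * slope v j

/-- One step of the staggered second-order scheme; entry `j` of the result is the new value at the
midpoint between the grid points number `j` and `j + 1`. -/
def step (f : ℝ → ℝ → ℝ) (uMin uMax lam : ℝ) (kk v : ℤ → ℝ) (j : ℤ) : ℝ :=
  (v j + v (j + 1)) / 2 - (slope v (j + 1) - slope v j) / 8
    - lam * (f (kk (j + 1)) (midValue f uMin uMax lam kk v (j + 1))
        - f (kk j) (midValue f uMin uMax lam kk v j))

/-- Discretized coefficient on the time-level-`n` grid: entry `j` is the mean of `k` over the cell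
centred at `(j + n / 2) * dx`. -/
def coeff (k : ℝ → ℝ) (dx : ℝ) (n : ℕ) (j : ℤ) : ℝ :=
  cellAvg k dx ((j : ℝ) + (n : ℝ) / 2)

/-- The numerical solution. Entry `(n, j)` is the value at time level `n` at the grid point
`(j + n / 2) * dx`, so the indices of level `n` run exactly through the points `p * dx` with
`p + n / 2` an integer. -/
def sol (f : ℝ → ℝ → ℝ) (uMin uMax : ℝ) (k u₀ : ℝ → ℝ) (lam dx : ℝ) : ℕ → ℤ → ℝ
  | 0 => fun j => cellAvg u₀ dx (j : ℝ)
  | n + 1 => step f uMin uMax lam (coeff k dx n) (sol f uMin uMax k u₀ lam dx n)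

/-- The increment `v_{j+1} - v_j`. -/
def diff (v : ℤ → ℝ) (j : ℤ) : ℝ := v (j + 1) - v j

/-- `β = lam * f_u(k̃, ũ)` with `k̃`, `ũ` the means of the values at the grid points `j`, `j + 1`. -/
def beta (f : ℝ → ℝ → ℝ) (uMin uMax lam : ℝ) (kk v : ℤ → ℝ) (j : ℤ) : ℝ :=
  lam * fluxU f uMin uMax ((kk j + kk (j + 1)) / 2) ((v j + v (j + 1)) / 2)

/-- The weight `ν` at the midpoint between the grid points `j` and `j + 1`; `kMid` is the mean of
`k` over the cell between these two points. If the increment of `v` vanishes, both slopes vanish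
and the quotients are read as `0`. -/
def weight (f : ℝ → ℝ → ℝ) (uMin uMax lam : ℝ) (kk v : ℤ → ℝ) (kMid : ℝ) (j : ℤ) : ℝ :=
  1 / 8 * (1 - 4 * beta f uMin uMax lam kk v j ^ 2) *
    (1 - 1 / 16 * (1 - 4 * beta f uMin uMax lam kk v j ^ 2)
          * (diff (slope v) j / diff v j) ^ 2
      - beta f uMin uMax lam kk v j * (diff (slope v) j / diff v j)
      - (slope v (j + 1) + slope v j) / (2 * diff v j)) *
    fluxUU f uMin uMax kMid ((v j + v (j + 1)) / 2)

/-- The weight `ν` at time level `n`, at the point `(j + n / 2 + 1 / 2) * dx`. -/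
def nu (f : ℝ → ℝ → ℝ) (uMin uMax : ℝ) (k u₀ : ℝ → ℝ) (lam dx : ℝ) (n : ℕ) (j : ℤ) : ℝ :=
  weight f uMin uMax lam (coeff k dx n) (sol f uMin uMax k u₀ lam dx n)
    (cellAvg k dx ((j : ℝ) + (n : ℝ) / 2 + 1 / 2)) j

end NTScheme

end

noncomputable section

namespace NTScheme

section FluxHypotheses

variable {f : ℝ → ℝ → ℝ} {kMin kMax uMin uMax γ₁ γ₂ lam κ : ℝ}

/-! ### Consequences of the flux hypotheses -/

/-! The core is a discrete energy inequality. In a cell with increment `d`, the limiter makes the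
slopes at the right and left ends `s * d` and `t * d` with `s, t ∈ [0, 1]`. Put `w = 1 - (s + t) /
2`. Since `|s - t| ≤ 2 * w`, the bracket in `ν` lies between `0` and `2 * w` (`bracket_bounds`).
This gives (i) and reduces (ii) to summing `w * d ^ 2`, which is `dissipation` (`weight_bounds`).

For the entropy `u ^ 2 / 2` the averaging in the scheme dissipates about `w * d ^ 2 / 8`. Where `w`
is small, the trapezoidal error of the convex flux leaves terms of size `E * d ^ 2`, with `E = lam *
|f_u(u1) - f_u(u0)|`, which `w` does not control. Hence the term `-4 * lam * f_u * σ * |σ|` in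
`entropyFlux`: it telescopes in space and, as `f_u` increases with `u`, its increment over a cell is
about `-4 * E * d ^ 2` there (`cell_algebra`, `cell_energy_of_eq`). A jump of the coefficient costs
at most a constant times its size, because `f` and `f_u` are Lipschitz in `k` uniformly in `u`
(`exists_cell_energy`).

The energy over the whole line may be infinite, so the inequality is summed over finite windows with
bounds independent of the window (`sum_dissipation_le`). The maximum principle `cellNew_mem` bounds
the boundary fluxes. By convexity the energy lost in a window is at most `-∑ u⁰ (uᴺ - u⁰)`; the
conservation form and Abel summation against the BV initial data bound this by a constant times `N`.
No variation bound on the solution at later times is needed. Since `dx * N` stays bounded and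
windows exhaust `ℤ`, (ii) follows. -/

theorem FluxHyp.uMin_lt_uMax (hf : FluxHyp f kMin kMax uMin uMax γ₁ γ₂)
    (hk : kMin ≤ kMax) (hu : uMin ≤ uMax) : uMin < uMax := by
  refine lt_of_le_of_ne hu fun h => ?_
  subst h
  have h1 := (hf.fuu_bounds kMin (left_mem_Icc.2 hk) uMin (left_mem_Icc.2 hu)).1
  -- On a one-point interval the derivative takes its default value `0`, contradicting `γ₁ > 0`.
  have h2 : fluxUU f uMin uMin kMin uMin = 0 := by
    rw [fluxUU, iteratedDerivWithin_succ, Icc_self]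
    refine derivWithin_zero_of_not_accPt fun h => ?_
    rw [accPt_iff_frequently] at h
    obtain ⟨y, hy⟩ := h.exists
    exact hy.1 hy.2
  linarith [hf.gamma_pos]

theorem FluxHyp.gamma_le (hf : FluxHyp f kMin kMax uMin uMax γ₁ γ₂)
    (hk : kMin ≤ kMax) (hu : uMin ≤ uMax) : γ₁ ≤ γ₂ :=
  have h := hf.fuu_bounds kMin (left_mem_Icc.2 hk) uMin (left_mem_Icc.2 hu)
  h.1.trans h.2

theorem FluxHyp.hasDerivWithinAt (hf : FluxHyp f kMin kMax uMin uMax γ₁ γ₂) {k u : ℝ}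
    (hk : k ∈ Icc kMin kMax) (hu : u ∈ Icc uMin uMax) :
    HasDerivWithinAt (f k) (fluxU f uMin uMax k u) (Icc uMin uMax) u :=
  ((hf.smooth_u k hk).differentiableOn (by norm_num) u hu).hasDerivWithinAt

theorem FluxHyp.hasDerivWithinAt_fluxU (hf : FluxHyp f kMin kMax uMin uMax γ₁ γ₂)
    (huu : uMin < uMax) {k u : ℝ} (hk : k ∈ Icc kMin kMax) (hu : u ∈ Icc uMin uMax) :
    HasDerivWithinAt (fluxU f uMin uMax k) (fluxUU f uMin uMax k u) (Icc uMin uMax) u := by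
  have hd : DifferentiableOn ℝ (iteratedDerivWithin 1 (f k) (Icc uMin uMax)) (Icc uMin uMax) :=
    (hf.smooth_u k hk).differentiableOn_iteratedDerivWithin (by norm_num) (uniqueDiffOn_Icc huu)
  have h1 : iteratedDerivWithin 1 (f k) (Icc uMin uMax) = fluxU f uMin uMax k := by
    rw [iteratedDerivWithin_one]; rfl
  have h2 : fluxUU f uMin uMax k u = derivWithin (fluxU f uMin uMax k) (Icc uMin uMax) u := by
    rw [fluxUU, iteratedDerivWithin_succ, h1]
  rw [h1] at hd
  rw [h2]
  exact (hd u hu).hasDerivWithinAt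

theorem FluxHyp.fluxU_sub_bounds (hf : FluxHyp f kMin kMax uMin uMax γ₁ γ₂)
    (huu : uMin < uMax) {k x y : ℝ} (hk : k ∈ Icc kMin kMax) (hx : x ∈ Icc uMin uMax)
    (hy : y ∈ Icc uMin uMax) (hxy : x ≤ y) :
    γ₁ * (y - x) ≤ fluxU f uMin uMax k y - fluxU f uMin uMax k x ∧
      fluxU f uMin uMax k y - fluxU f uMin uMax k x ≤ γ₂ * (y - x) := by
  have hder : ∀ u ∈ interior (Icc uMin uMax),
      HasDerivAt (fluxU f uMin uMax k) (fluxUU f uMin uMax k u) u := fun u hu =>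
    (hf.hasDerivWithinAt_fluxU huu hk (interior_subset hu)).hasDerivAt
      (mem_interior_iff_mem_nhds.1 hu)
  have hc : ContinuousOn (fluxU f uMin uMax k) (Icc uMin uMax) := fun u hu =>
    (hf.hasDerivWithinAt_fluxU huu hk hu).continuousWithinAt
  have hd : DifferentiableOn ℝ (fluxU f uMin uMax k) (interior (Icc uMin uMax)) := fun u hu =>
    (hder u hu).differentiableAt.differentiableWithinAt
  constructor
  · refine (convex_Icc uMin uMax).mul_sub_le_image_sub_of_le_deriv hc hd (fun u hu => ?_)
      x hx y hy hxy
    rw [(hder u hu).deriv]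
    exact (hf.fuu_bounds k hk u (interior_subset hu)).1
  · refine (convex_Icc uMin uMax).image_sub_le_mul_sub_of_deriv_le hc hd (fun u hu => ?_)
      x hx y hy hxy
    rw [(hder u hu).deriv]
    exact (hf.fuu_bounds k hk u (interior_subset hu)).2

theorem FluxHyp.tangent_le (hf : FluxHyp f kMin kMax uMin uMax γ₁ γ₂)
    {k x y : ℝ} (hk : k ∈ Icc kMin kMax) (hx : x ∈ Icc uMin uMax)
    (hy : y ∈ Icc uMin uMax) :
    f k x + fluxU f uMin uMax k x * (y - x) ≤ f k y := by
  have hc := (hf.strictConvex k hk).convexOn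
  rcases lt_trichotomy x y with h | h | h
  · have := hc.le_slope_of_hasDerivWithinAt hx hy h (hf.hasDerivWithinAt hk hx)
    rw [slope_def_field, le_div_iff₀ (by linarith)] at this
    linarith
  · simp [h]
  · have := hc.slope_le_of_hasDerivWithinAt hy hx h (hf.hasDerivWithinAt hk hx)
    rw [slope_def_field, div_le_iff₀ (by linarith)] at this
    linarith

/-- The flux is affine in the coefficient. -/
theorem FluxHyp.affine (hf : FluxHyp f kMin kMax uMin uMax γ₁ γ₂) (hkk : kMin < kMax)
    {k u : ℝ} (hk : k ∈ Icc kMin kMax) (hu : u ∈ Icc uMin uMax) :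
    f k u = f kMin u + (k - kMin) / (kMax - kMin) * (f kMax u - f kMin u) := by
  set S := Icc kMin kMax
  have hS : UniqueDiffOn ℝ S := uniqueDiffOn_Icc hkk
  set h : ℝ → ℝ := fun k => f k u with hh
  have hsm : ContDiffOn ℝ 2 h S := hf.smooth_k u hu
  have hdiff : DifferentiableOn ℝ h S := hsm.differentiableOn (by norm_num)
  have hd1 : DifferentiableOn ℝ (iteratedDerivWithin 1 h S) S :=
    hsm.differentiableOn_iteratedDerivWithin (by norm_num) hS
  have hz : ∀ x ∈ S, derivWithin (iteratedDerivWithin 1 h S) S x = 0 := fun x hx => by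
    rw [← iteratedDerivWithin_succ]; exact hf.fkk_zero u hu x hx
  rw [iteratedDerivWithin_one] at hd1 hz
  have hmin : kMin ∈ S := left_mem_Icc.2 hkk.le
  have hmax : kMax ∈ S := right_mem_Icc.2 hkk.le
  -- Vanishing of `f_kk` makes `f_k` a constant `c`; then `f - c * k` has zero derivative in `k`.
  have hconst : ∀ x ∈ S, derivWithin h S x = derivWithin h S kMin := fun x hx =>
    (convex_Icc kMin kMax).is_const_of_fderivWithin_eq_zero hd1
      (fun y hy => by
        ext
        simpa [derivWithin] using hz y hy) hx hmin
  set c := derivWithin h S kMin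
  have hlin : ∀ x ∈ S, h x - c * x = h kMin - c * kMin := fun x hx => by
    refine (convex_Icc kMin kMax).is_const_of_fderivWithin_eq_zero (𝕜 := ℝ)
      (f := fun x => h x - c * x)
      (hdiff.sub (by fun_prop)) (fun y hy => ?_) hx hmin
    have : HasDerivWithinAt (fun x => h x - c * x) (c - c * 1) S y := by
      have h1 := (hdiff y hy).hasDerivWithinAt
      rw [hconst y hy] at h1
      exact h1.sub ((hasDerivWithinAt_id y S).const_mul c)
    ext
    have h2 := this.derivWithin (hS y hy)
    simp only [mul_one, sub_self] at h2
    simpa [derivWithin] using h2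
  have e1 := hlin k hk
  have e2 := hlin kMax hmax
  simp only [hh] at e1 e2
  have : kMax - kMin ≠ 0 := by linarith
  field_simp
  have e3 : f k u = f kMin u + c * (k - kMin) := by linarith
  have e4 : f kMax u = f kMin u + c * (kMax - kMin) := by linarith
  rw [e3, e4]; ring

/-- Differentiating the affine formula in `u`. The regularity of `f_u(·, u)` is assumed for each `u`
separately; affinity yields a Lipschitz constant in `k` uniform in `u`. -/
theorem FluxHyp.fluxU_affine (hf : FluxHyp f kMin kMax uMin uMax γ₁ γ₂) (hkk : kMin < kMax)
    (huu : uMin < uMax) {k u : ℝ} (hk : k ∈ Icc kMin kMax) (hu : u ∈ Icc uMin uMax) :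
    fluxU f uMin uMax k u = fluxU f uMin uMax kMin u + (k - kMin) / (kMax - kMin) *
      (fluxU f uMin uMax kMax u - fluxU f uMin uMax kMin u) := by
  have h0 := hf.hasDerivWithinAt (left_mem_Icc.2 hkk.le) hu
  have h1 := hf.hasDerivWithinAt (right_mem_Icc.2 hkk.le) hu
  have h2 := (h0.add ((h1.sub h0).const_mul ((k - kMin) / (kMax - kMin)))).congr
    (fun y hy => hf.affine hkk hk hy) (hf.affine hkk hk hu)
  exact h2.derivWithin (uniqueDiffOn_Icc huu u hu)

/-- The properties of the flux used by the energy estimate. -/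
structure FluxBounds (f fu : ℝ → ℝ → ℝ) (kMin kMax uMin uMax γ₁ γ₂ lam κ L B : ℝ) : Prop where
  k_le : kMin ≤ kMax
  u_le : uMin ≤ uMax
  gamma_pos : 0 < γ₁
  gamma_le : γ₁ ≤ γ₂
  lam_pos : 0 < lam
  kappa_nonneg : 0 ≤ κ
  kappa_le : κ ≤ 1 / 4000
  kappa_gamma : κ * γ₂ ≤ γ₁ / 7500
  L_nonneg : 0 ≤ L
  cont : ∀ k ∈ Icc kMin kMax, ContinuousOn (f k) (Icc uMin uMax)
  tangent_le : ∀ k ∈ Icc kMin kMax, ∀ x ∈ Icc uMin uMax, ∀ y ∈ Icc uMin uMax,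
    f k x + fu k x * (y - x) ≤ f k y
  fu_sub : ∀ k ∈ Icc kMin kMax, ∀ x ∈ Icc uMin uMax, ∀ y ∈ Icc uMin uMax, x ≤ y →
    γ₁ * (y - x) ≤ fu k y - fu k x ∧ fu k y - fu k x ≤ γ₂ * (y - x)
  cfl : ∀ k ∈ Icc kMin kMax, ∀ u ∈ Icc uMin uMax, lam * |fu k u| ≤ κ
  lip_f : ∀ k ∈ Icc kMin kMax, ∀ k' ∈ Icc kMin kMax, ∀ u ∈ Icc uMin uMax,
    |f k u - f k' u| ≤ L * |k - k'|
  lip_fu : ∀ k ∈ Icc kMin kMax, ∀ k' ∈ Icc kMin kMax, ∀ u ∈ Icc uMin uMax,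
    |fu k u - fu k' u| ≤ L * |k - k'|
  bound : ∀ k ∈ Icc kMin kMax, ∀ u ∈ Icc uMin uMax, |f k u| ≤ B
  eq_at_max : ∀ k₁ ∈ Icc kMin kMax, ∀ k₂ ∈ Icc kMin kMax, f k₁ uMax = f k₂ uMax
  eq_at_min : ∀ k₁ ∈ Icc kMin kMax, ∀ k₂ ∈ Icc kMin kMax, f k₁ uMin = f k₂ uMin

/-- The tangent inequality used at both points bounds the difference from both sides, so no mean
value theorem is needed. -/
theorem lipschitz_of_tangent {fk g : ℝ → ℝ} {I : Set ℝ} {lam κ : ℝ} (hlam : 0 < lam)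
    (ht : ∀ x ∈ I, ∀ y ∈ I, fk x + g x * (y - x) ≤ fk y)
    (hg : ∀ x ∈ I, lam * |g x| ≤ κ) {x y : ℝ} (hx : x ∈ I) (hy : y ∈ I) :
    lam * |fk y - fk x| ≤ κ * |y - x| := by
  have key : ∀ x ∈ I, ∀ y ∈ I, lam * (fk x - fk y) ≤ κ * |y - x| := fun x hx y hy => by
    have h1 := ht x hx y hy
    have h2 : -(g x * (y - x)) ≤ |g x| * |y - x| := by
      rw [← abs_mul]; exact neg_le_abs _
    calc lam * (fk x - fk y) ≤ lam * (|g x| * |y - x|) :=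
          mul_le_mul_of_nonneg_left (by linarith) hlam.le
      _ = lam * |g x| * |y - x| := by ring
      _ ≤ κ * |y - x| := mul_le_mul_of_nonneg_right (hg x hx) (abs_nonneg _)
  have h0 : lam * |fk y - fk x| = |lam * (fk y - fk x)| := by rw [abs_mul, abs_of_pos hlam]
  rw [h0, abs_le]
  have h1 := key x hx y hy
  have h2 := key y hy x hx
  rw [abs_sub_comm] at h2
  constructor <;> linarith

theorem FluxBounds.lip_u {fu : ℝ → ℝ → ℝ} {L B : ℝ}
    (h : FluxBounds f fu kMin kMax uMin uMax γ₁ γ₂ lam κ L B)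
    {k x y : ℝ} (hk : k ∈ Icc kMin kMax) (hx : x ∈ Icc uMin uMax) (hy : y ∈ Icc uMin uMax) :
    lam * |f k y - f k x| ≤ κ * |y - x| :=
  lipschitz_of_tangent h.lam_pos (h.tangent_le k hk) (h.cfl k hk) hx hy

theorem FluxHyp.exists_fluxBounds (hf : FluxHyp f kMin kMax uMin uMax γ₁ γ₂)
    (hk : kMin ≤ kMax) (hu : uMin ≤ uMax) (hlam : 0 < lam)
    (hcfl : CFL f kMin kMax uMin uMax γ₁ γ₂ lam κ) :
    ∃ L B, FluxBounds f (fluxU f uMin uMax) kMin kMax uMin uMax γ₁ γ₂ lam κ L B := by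
  have huu := hf.uMin_lt_uMax hk hu
  have hγ := hf.gamma_le hk hu
  have hγ₂ : 0 < γ₂ := hf.gamma_pos.trans_le hγ
  obtain ⟨hc, hκ1, hκ2, -, -⟩ := hcfl
  have hmink : kMin ∈ Icc kMin kMax := left_mem_Icc.2 hk
  have hmaxk : kMax ∈ Icc kMin kMax := right_mem_Icc.2 hk
  have hminu : uMin ∈ Icc uMin uMax := left_mem_Icc.2 hu
  have hκ0 : 0 ≤ κ := le_trans (by positivity) (hc kMin hmink uMin hminu)
  -- The value at `uMin` is the same for all `k`, and the CFL bound controls the growth in `u` from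
  -- there.
  set B := |f kMin uMin| + κ / lam * (uMax - uMin)
  have hB : ∀ k ∈ Icc kMin kMax, ∀ u ∈ Icc uMin uMax, |f k u| ≤ B := fun k hk' u hu' => by
    have h1 := lipschitz_of_tangent hlam (fun x hx y hy => hf.tangent_le hk' hx hy)
      (hc k hk') hminu hu'
    have h2 : |f k u - f k uMin| ≤ κ / lam * |u - uMin| := by
      rw [div_mul_eq_mul_div, le_div_iff₀ hlam]; linarith
    have h3 : |u - uMin| ≤ uMax - uMin := by
      rw [abs_of_nonneg (by linarith [hu'.1])]; linarith [hu'.2]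
    have h4 := mul_le_mul_of_nonneg_left h3 (div_nonneg hκ0 hlam.le)
    have h5 := abs_add_le (f k u - f k uMin) (f k uMin)
    rw [sub_add_cancel, hf.eq_at_min k hk' kMin hmink] at h5
    rw [hf.eq_at_min k hk' kMin hmink] at h2
    linarith
  have hfu : ∀ k ∈ Icc kMin kMax, ∀ u ∈ Icc uMin uMax, |fluxU f uMin uMax k u| ≤ κ / lam :=
    fun k hk' u hu' => by rw [le_div_iff₀ hlam]; linarith [hc k hk' u hu']
  have hB0 : 0 ≤ B := by
    have := sub_nonneg.2 hu
    positivity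
  have hlip : ∃ L, 0 ≤ L ∧ (∀ k ∈ Icc kMin kMax, ∀ k' ∈ Icc kMin kMax, ∀ u ∈ Icc uMin uMax,
      |f k u - f k' u| ≤ L * |k - k'|) ∧
      ∀ k ∈ Icc kMin kMax, ∀ k' ∈ Icc kMin kMax, ∀ u ∈ Icc uMin uMax,
        |fluxU f uMin uMax k u - fluxU f uMin uMax k' u| ≤ L * |k - k'| := by
    rcases hk.eq_or_lt with rfl | hkk
    · refine ⟨0, le_rfl, fun k hk k' hk' u _ => ?_, fun k hk k' hk' u _ => ?_⟩ <;>
      · rw [Icc_self, mem_singleton_iff] at hk hk'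
        simp [hk, hk']
    · have hpos : 0 < kMax - kMin := by linarith
      have aux : ∀ k k' A A' D : ℝ, 0 ≤ D → |A'| ≤ D → |A| ≤ D → D ≤ B + κ / lam →
          |A + (k - kMin) / (kMax - kMin) * (A' - A)
            - (A + (k' - kMin) / (kMax - kMin) * (A' - A))|
          ≤ 2 * (B + κ / lam) / (kMax - kMin) * |k - k'| := fun k k' A A' D _ h1 h2 h3 => by
        have e : A + (k - kMin) / (kMax - kMin) * (A' - A)
            - (A + (k' - kMin) / (kMax - kMin) * (A' - A))
            = (A' - A) / (kMax - kMin) * (k - k') := by field_simp; ring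
        rw [e, abs_mul, abs_div, abs_of_pos hpos]
        gcongr
        linarith [abs_sub A' A]
      have hq : 0 ≤ κ / lam := div_nonneg hκ0 hlam.le
      refine ⟨2 * (B + κ / lam) / (kMax - kMin), by positivity,
        fun k hk' k' hk'' u hu' => ?_, fun k hk' k' hk'' u hu' => ?_⟩
      · rw [hf.affine hkk hk' hu', hf.affine hkk hk'' hu']
        exact aux _ _ _ _ B hB0 (hB _ hmaxk _ hu') (hB _ hmink _ hu') (by linarith)
      · rw [hf.fluxU_affine hkk huu hk' hu', hf.fluxU_affine hkk huu hk'' hu']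
        exact aux _ _ _ _ _ hq (hfu _ hmaxk _ hu') (hfu _ hmink _ hu') (by linarith)
  obtain ⟨L, hL0, hL1, hL2⟩ := hlip
  refine ⟨L, B, hk, hu, hf.gamma_pos, hγ, hlam, hκ0, hκ2, ?_, hL0,
    fun k hk' => (hf.smooth_u k hk').continuousOn,
    fun k hk' x hx y hy => hf.tangent_le hk' hx hy,
    fun k hk' x hx y hy => hf.fluxU_sub_bounds huu hk' hx hy, hc, hL1, hL2, hB,
    hf.eq_at_max, hf.eq_at_min⟩
  calc κ * γ₂ ≤ γ₁ / (7500 * γ₂) * γ₂ := mul_le_mul_of_nonneg_right hκ1 hγ₂.le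
    _ = γ₁ / 7500 := by field_simp

end FluxHypotheses

/-! ### The cell energy inequality -/

-- Here `p0`, `p1` are `lam * f_u` at the nodes, `g` is `lam` times the flux increment between the
-- mid-values, and `tr` is `lam` times the trapezoidal error. Every error is at most a multiple of
-- `κ * w * d ^ 2` or of `E * d ^ 2`. The former is absorbed by the viscosity `w * d ^ 2 / 8`, the
-- latter by the correction term.
set_option maxHeartbeats 800000 in
theorem cell_algebra {κ d s t p0 p1 E g tr : ℝ} (hκ0 : 0 ≤ κ) (hκ : κ ≤ 1 / 4000)
    (hs0 : 0 ≤ s) (hs1 : s ≤ 1) (ht0 : 0 ≤ t) (ht1 : t ≤ 1)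
    (hp0 : |p0| ≤ κ) (hp1 : |p1| ≤ κ) (hE : E = |p1 - p0|)
    (hsign : (p1 - p0) * (d * |d|) = E * d ^ 2)
    (hg : |g - p0 * (d - (p1 * s - p0 * t) * d / 2)|
      ≤ 2 * E * |d - (p1 * s - p0 * t) * d / 2|)
    (htr : tr ≤ 2 * E * (d - (p1 * s - p0 * t) * d / 2) ^ 2) :
    d ^ 2 * (-((1 - (s + t) / 2) / 8) + (s - t) ^ 2 / 128)
      + g * (d * (s - t) / 8 - d * (p1 * s + p0 * t) / 4 + g / 2) + tr
      - 4 * (p1 * s ^ 2 - p0 * t ^ 2) * (d * |d|)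
      ≤ -((1 - (s + t) / 2) * d ^ 2 / 20) := by
  set w := 1 - (s + t) / 2 with hw
  have hE0 : 0 ≤ E := hE ▸ abs_nonneg _
  have hE2 : E ≤ 2 * κ := by rw [hE]; linarith [abs_sub p1 p0]
  have hw0 : 0 ≤ w := by rw [hw]; linarith
  have hx : |s - t| ≤ 2 * w := by rw [abs_le]; constructor <;> rw [hw] <;> linarith
  have hx1 : |s - t| ≤ 1 := by rw [abs_le]; constructor <;> linarith
  have hpd : |p1 - p0| ≤ E := hE.ge
  -- the relative mid-value increment
  obtain ⟨ρ, hρ⟩ : ∃ ρ, ρ = (p1 * s - p0 * t) / 2 := ⟨_, rfl⟩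
  have hρ1 : |ρ| ≤ κ * w + E / 2 := by
    have e : ρ = (p1 * (s - t) + (p1 - p0) * t) / 2 := by rw [hρ]; ring
    rw [e, abs_div, abs_two]
    have h1 : |p1 * (s - t)| ≤ κ * (2 * w) := by rw [abs_mul]; gcongr
    have h2 : |(p1 - p0) * t| ≤ E * 1 := by
      rw [abs_mul, abs_of_nonneg ht0]; gcongr
    linarith [abs_add_le (p1 * (s - t)) ((p1 - p0) * t)]
  have hρ2 : |ρ| ≤ κ := by
    have h1 : |p1 * s| ≤ κ * 1 := by rw [abs_mul, abs_of_nonneg hs0]; gcongr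
    have h2 : |p0 * t| ≤ κ * 1 := by rw [abs_mul, abs_of_nonneg ht0]; gcongr
    rw [hρ, abs_div, abs_two]
    linarith [abs_sub (p1 * s) (p0 * t)]
  have em : d - (p1 * s - p0 * t) * d / 2 = d * (1 - ρ) := by rw [hρ]; ring
  rw [em] at hg htr
  have h1ρ : |1 - ρ| ≤ 1 + κ := by
    have := abs_sub 1 ρ
    rw [abs_one] at this; linarith
  have h1ρ' : (1 - ρ) ^ 2 ≤ 1.001 := by
    rw [← sq_abs]
    calc |1 - ρ| ^ 2 ≤ (1 + 1/4000) ^ 2 := by gcongr; linarith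
      _ ≤ _ := by norm_num
  -- relative numerical flux
  have hgd : |g - p0 * d| ≤ (3 * E + κ * w) * |d| := by
    have e : g - p0 * d = (g - p0 * (d * (1 - ρ))) - p0 * ρ * d := by ring
    rw [e]
    refine (abs_sub _ _).trans ?_
    have h1 : |p0 * ρ * d| ≤ κ * (κ * w + E / 2) * |d| := by
      rw [abs_mul, abs_mul]; gcongr
    have h2 : 2 * E * |d * (1 - ρ)| ≤ 2 * E * (|d| * (1 + κ)) := by
      rw [abs_mul]; gcongr
    have h3 : 2 * E * (1 + κ) + κ * (κ * w + E / 2) ≤ 3 * E + κ * w := by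
      have := mul_le_mul_of_nonneg_left hκ hE0
      have := mul_le_mul_of_nonneg_right hκ (mul_nonneg hκ0 hw0)
      nlinarith [mul_nonneg hκ0 hw0]
    have h4 := mul_le_mul_of_nonneg_right h3 (abs_nonneg d)
    linarith
  have hgabs : |g| ≤ 8 * κ * |d| := by
    have h1 : |p0 * d| ≤ κ * |d| := by rw [abs_mul]; gcongr
    have h2 := abs_add_le (g - p0 * d) (p0 * d)
    rw [sub_add_cancel] at h2
    have h3 : 3 * E + κ * w ≤ 7 * κ := by
      have : κ * w ≤ κ * 1 := by gcongr; rw [hw]; linarith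
      linarith
    have h4 := mul_le_mul_of_nonneg_right h3 (abs_nonneg d)
    linarith
  -- Second-order cancellation: with `g` replaced by `p0 * d` and `p1` by `p0`, the last two terms
  -- combine to `p0 * w * d / 2`, which vanishes with `w`.
  have hbr : |d * (s - t) / 8 - d * (p1 * s + p0 * t) / 4 + g / 2| ≤ (w / 2 + 2 * E) * |d| := by
    have e : d * (s - t) / 8 - d * (p1 * s + p0 * t) / 4 + g / 2
        = d * ((s - t) / 8) + d * (p0 * w / 2 - (p1 - p0) * s / 4) + (g - p0 * d) / 2 := by
      rw [hw]; ring
    rw [e]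
    refine (abs_add_three _ _ _).trans ?_
    have h1 : |d * ((s - t) / 8)| ≤ |d| * (2 * w / 8) := by
      rw [abs_mul, abs_div, abs_of_pos (by norm_num : (0:ℝ) < 8)]; gcongr
    have h2 : |p0 * w / 2 - (p1 - p0) * s / 4| ≤ κ * w / 2 + E / 4 := by
      refine (abs_sub _ _).trans ?_
      have a1 : |p0 * w / 2| ≤ κ * w / 2 := by
        rw [abs_div, abs_two, abs_mul, abs_of_nonneg hw0]; gcongr
      have a2 : |(p1 - p0) * s / 4| ≤ E * 1 / 4 := by
        rw [abs_div, abs_of_pos (by norm_num : (0:ℝ) < 4), abs_mul, abs_of_nonneg hs0]; gcongr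
      linarith
    have h3 : |d * (p0 * w / 2 - (p1 - p0) * s / 4)| ≤ |d| * (κ * w / 2 + E / 4) := by
      rw [abs_mul]; gcongr
    have h4 : |(g - p0 * d) / 2| ≤ (3 * E + κ * w) * |d| / 2 := by
      rw [abs_div, abs_two]; gcongr
    have h5 : 2 * w / 8 + (κ * w / 2 + E / 4) + (3 * E + κ * w) / 2 ≤ w / 2 + 2 * E := by
      nlinarith [mul_le_mul_of_nonneg_right hκ hw0]
    have h6 := mul_le_mul_of_nonneg_right h5 (abs_nonneg d)
    linarith
  have hprod : g * (d * (s - t) / 8 - d * (p1 * s + p0 * t) / 4 + g / 2)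
      ≤ 8 * κ * (w / 2 + 2 * E) * d ^ 2 := by
    refine (le_abs_self _).trans ?_
    rw [abs_mul, ← sq_abs d]
    calc _ ≤ (8 * κ * |d|) * ((w / 2 + 2 * E) * |d|) := by gcongr
      _ = _ := by ring
  have htr' : tr ≤ 2 * E * 1.001 * d ^ 2 := by
    calc tr ≤ 2 * E * (1 - ρ) ^ 2 * d ^ 2 := by rw [mul_pow] at htr; linarith
      _ ≤ _ := by gcongr
  -- The gain is `-4 * s ^ 2 * E`, where `s ^ 2 ≥ 1 - 4 * w`. The loss `16 * E * w` is at most `32 *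
  -- κ * w` since `E ≤ 2 * κ`, and the part with `s - t` adds `16 * κ * w`.
  have hvisc : -(4 * (p1 * s ^ 2 - p0 * t ^ 2) * (d * |d|))
      ≤ (-4 * E + 48 * κ * w) * d ^ 2 := by
    have e : -(4 * (p1 * s ^ 2 - p0 * t ^ 2) * (d * |d|))
        = -4 * s ^ 2 * ((p1 - p0) * (d * |d|)) + (-(4 * p0 * (s - t) * (s + t)) * (d * |d|)) := by
      ring
    rw [e, hsign]
    have hz : |p0 * (s - t) * (s + t)| ≤ κ * (2 * w) * 2 := by
      rw [abs_mul, abs_mul, abs_of_nonneg (add_nonneg hs0 ht0)]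
      have : s + t ≤ 2 := by linarith
      gcongr
    have hdd : |d * (|d|)| = d ^ 2 := by rw [abs_mul, abs_abs, ← sq, sq_abs]
    have h1 : -(4 * p0 * (s - t) * (s + t)) * (d * |d|) ≤ 4 * κ * (2 * w) * 2 * d ^ 2 := by
      have h0 : -(p0 * (s - t) * (s + t) * (d * |d|)) ≤ κ * (2 * w) * 2 * d ^ 2 := by
        refine (neg_le_abs _).trans ?_
        rw [abs_mul, hdd]
        gcongr
      linarith
    have h2 : 1 - 4 * w ≤ s ^ 2 := by
      rw [hw]; nlinarith [sq_nonneg (s - 1)]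
    have h3 : -4 * s ^ 2 * (E * d ^ 2) ≤ -4 * (1 - 4 * w) * (E * d ^ 2) := by
      have := mul_le_mul_of_nonneg_right h2 (mul_nonneg hE0 (sq_nonneg d))
      linarith
    have h4 : E * w * d ^ 2 ≤ 2 * κ * w * d ^ 2 := by gcongr
    linarith
  have hst : (s - t) ^ 2 ≤ 2 * w := by
    rw [← sq_abs]; nlinarith [abs_nonneg (s - t)]
  -- The coefficient of `E` is about `2 - 4 < 0`, and that of `w` is about `-1/8 + 1/64 + 52 * κ <
  -- -1/20`.
  have hfin : (-(w / 8) + (s - t) ^ 2 / 128) + 8 * κ * (w / 2 + 2 * E) + 2 * E * 1.001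
      + (-4 * E + 48 * κ * w) ≤ -(w / 20) := by
    have := mul_le_mul_of_nonneg_right hκ hw0
    have := mul_le_mul_of_nonneg_right hκ hE0
    nlinarith
  have := mul_le_mul_of_nonneg_right hfin (sq_nonneg d)
  linarith

/-- Error of the trapezoidal rule for a convex function, in terms of its subgradients. -/
theorem trapezoid_sub_integral_le {h p : ℝ → ℝ} {a b x y : ℝ}
    (hc : ContinuousOn h (Icc a b))
    (ht : ∀ x ∈ Icc a b, ∀ y ∈ Icc a b, h x + p x * (y - x) ≤ h y)
    (hx : x ∈ Icc a b) (hy : y ∈ Icc a b) :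
    (y - x) * (h x + h y) / 2 - ∫ z in x..y, h z ≤ |p y - p x| * (y - x) ^ 2 := by
  rcases eq_or_ne x y with rfl | hne
  · simp
  have hyx : y - x ≠ 0 := sub_ne_zero.2 hne.symm
  set S := (h y - h x) / (y - x) with hS
  -- The trapezoidal value is the integral of the chord, so it suffices to bound chord minus `h`
  -- pointwise.
  have hint : ∫ z in x..y, (h x + S * (z - x)) = (y - x) * (h x + h y) / 2 := by
    have e : ∀ z, h x + S * (z - x) = (h x - S * x) + S * z := fun z => by ring
    simp_rw [e]
    rw [intervalIntegral.integral_add (by simp)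
        (Continuous.intervalIntegrable (by fun_prop) _ _),
      intervalIntegral.integral_const, intervalIntegral.integral_const_mul, integral_id]
    rw [hS, smul_eq_mul]
    field_simp
    ring
  have hsub : uIcc x y ⊆ Icc a b := uIcc_subset_Icc hx hy
  have hhi : IntervalIntegrable h volume x y := (hc.mono hsub).intervalIntegrable
  rw [← hint, ← intervalIntegral.integral_sub (Continuous.intervalIntegrable (by fun_prop) _ _) hhi]
  have hbd : ∀ z ∈ uIoc x y, ‖h x + S * (z - x) - h z‖ ≤ |p y - p x| * |y - x| := by
    intro z hz
    have hz' : z ∈ uIcc x y := uIoc_subset_uIcc hz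
    have hzI := hsub hz'
    have t1 := ht x hx z hzI
    have t2 := ht y hy z hzI
    have t3 := ht x hx y hy
    have t4 := ht y hy x hx
    have t5 := ht z hzI x hx
    have t6 := ht z hzI y hy
    obtain ⟨τ, hτ0, hτ1, hzτ⟩ : ∃ τ, 0 ≤ τ ∧ τ ≤ 1 ∧ z = x + τ * (y - x) := by
      rw [← segment_eq_uIcc] at hz'
      obtain ⟨α, β, hα, hβ, hαβ, rfl⟩ := hz'
      refine ⟨β, hβ, by linarith, ?_⟩
      rw [show α = 1 - β by linarith]; simp only [smul_eq_mul]; ring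
    have eS : S * (z - x) = τ * (h y - h x) := by
      rw [hzτ, hS]; field_simp; ring
    have hA : (p y - p x) * (y - x) ≤ |p y - p x| * |y - x| := by
      rw [← abs_mul]; exact le_abs_self _
    have hA0 : 0 ≤ (p y - p x) * (y - x) := by linarith
    rw [Real.norm_eq_abs, eS, abs_le]
    have hzx : z - x = τ * (y - x) := by rw [hzτ]; ring
    have hzy : x - z = -τ * (y - x) := by rw [hzτ]; ring
    have hyz : y - z = (1 - τ) * (y - x) := by rw [hzτ]; ring
    rw [hzx] at t1
    rw [hzy] at t5
    rw [hyz] at t6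
    have h1 : h z ≤ (1 - τ) * h x + τ * h y := by
      have a1 := mul_le_mul_of_nonneg_left t5 (sub_nonneg.2 hτ1)
      have a2 := mul_le_mul_of_nonneg_left t6 hτ0
      linarith
    have h2 : τ * (h y - h x - p x * (y - x)) ≤ 1 * ((p y - p x) * (y - x)) := by
      refine mul_le_mul hτ1 (by linarith) (by linarith) (by norm_num)
    constructor
    · linarith
    · linarith
  refine (le_abs_self _).trans ((intervalIntegral.norm_integral_le_of_norm_le_const hbd).trans ?_)
  rw [mul_assoc, abs_mul_abs_self, sq]

/-! ### Energy balance of a single cell with constant coefficient. -/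

/-- The mid-time value at a node with value `u` and slope `σ`. -/
def midVal (fu : ℝ → ℝ → ℝ) (lam k u σ : ℝ) : ℝ := u - lam / 2 * fu k u * σ

/-- The updated value of the cell between two nodes. -/
def cellNew (f fu : ℝ → ℝ → ℝ) (lam k0 k1 u0 u1 σ0 σ1 : ℝ) : ℝ :=
  (u0 + u1) / 2 - (σ1 - σ0) / 8
    - lam * (f k1 (midVal fu lam k1 u1 σ1) - f k0 (midVal fu lam k0 u0 σ0))

/-- A numerical flux for the quadratic entropy, corrected by a slope-dependent term. -/
def entropyFlux (f fu : ℝ → ℝ → ℝ) (uMin lam k u σ : ℝ) : ℝ :=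
  u * σ / 8 + lam * (midVal fu lam k u σ * f k (midVal fu lam k u σ)
    - ∫ y in uMin..midVal fu lam k u σ, f k y) - 4 * (lam * fu k u) * (σ * |σ|)

section Energy

variable {f fu : ℝ → ℝ → ℝ} {kMin kMax uMin uMax γ₁ γ₂ lam κ L B : ℝ}

namespace FluxBounds

theorem abs_lam_fu_le (h : FluxBounds f fu kMin kMax uMin uMax γ₁ γ₂ lam κ L B)
    {k u : ℝ} (hk : k ∈ Icc kMin kMax) (hu : u ∈ Icc uMin uMax) : |lam * fu k u| ≤ κ := by
  rw [abs_mul, abs_of_pos h.lam_pos]; exact h.cfl k hk u hu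

theorem abs_fu_sub_le (h : FluxBounds f fu kMin kMax uMin uMax γ₁ γ₂ lam κ L B)
    {k x y : ℝ} (hk : k ∈ Icc kMin kMax) (hx : x ∈ Icc uMin uMax) (hy : y ∈ Icc uMin uMax) :
    γ₁ * |y - x| ≤ |fu k y - fu k x| ∧ |fu k y - fu k x| ≤ γ₂ * |y - x| ∧
      0 ≤ (fu k y - fu k x) * (y - x) := by
  have hγ := h.gamma_pos
  rcases le_total x y with hxy | hxy
  · have h1 := h.fu_sub k hk x hx y hy hxy
    have h0 : 0 ≤ y - x := sub_nonneg.2 hxy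
    have h2 := mul_nonneg hγ.le h0
    rw [abs_of_nonneg h0, abs_of_nonneg (by linarith)]
    exact ⟨h1.1, h1.2, mul_nonneg (by linarith) h0⟩
  · have h1 := h.fu_sub k hk y hy x hx hxy
    have h0 : 0 ≤ x - y := sub_nonneg.2 hxy
    have h2 := mul_nonneg hγ.le h0
    rw [abs_sub_comm, abs_of_nonneg h0, abs_sub_comm, abs_of_nonneg (by linarith)]
    exact ⟨h1.1, h1.2, mul_nonneg_of_nonpos_of_nonpos (by linarith) (by linarith)⟩

theorem midVal_mem (h : FluxBounds f fu kMin kMax uMin uMax γ₁ γ₂ lam κ L B)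
    {k u σ : ℝ} (hk : k ∈ Icc kMin kMax) (hu : u ∈ Icc uMin uMax)
    (hp : u + σ ∈ Icc uMin uMax) (hm : u - σ ∈ Icc uMin uMax) :
    midVal fu lam k u σ ∈ Icc uMin uMax := by
  have h1 := abs_le.1 (h.abs_lam_fu_le hk hu)
  have h2 := h.kappa_le
  have e : midVal fu lam k u σ
      = (1 - lam * fu k u / 2) / 2 * (u + σ) + (1 + lam * fu k u / 2) / 2 * (u - σ) := by
    rw [midVal]; ring
  rw [e]
  have c1 : 0 ≤ (1 - lam * fu k u / 2) / 2 := by linarith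
  have c2 : 0 ≤ (1 + lam * fu k u / 2) / 2 := by linarith
  exact convex_Icc uMin uMax hp hm c1 c2 (by ring)

theorem abs_midVal_sub_le (h : FluxBounds f fu kMin kMax uMin uMax γ₁ γ₂ lam κ L B)
    {k u σ : ℝ} (hk : k ∈ Icc kMin kMax) (hu : u ∈ Icc uMin uMax) :
    |midVal fu lam k u σ - u| ≤ κ / 2 * |σ| := by
  have e : midVal fu lam k u σ - u = -(lam * fu k u) / 2 * σ := by rw [midVal]; ring
  rw [e, abs_mul, abs_div, abs_neg, abs_two]
  gcongr
  exact h.abs_lam_fu_le hk hu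

/-- The left side is exactly the quadratic expression of `cell_algebra`: the products of the mean
value with the slope and flux increments cancel against the entropy flux. -/
theorem cell_energy_of_eq (h : FluxBounds f fu kMin kMax uMin uMax γ₁ γ₂ lam κ L B)
    {k u0 u1 s t : ℝ} (hk : k ∈ Icc kMin kMax)
    (hu0 : u0 ∈ Icc uMin uMax) (hu1 : u1 ∈ Icc uMin uMax)
    (hs0 : 0 ≤ s) (hs1 : s ≤ 1) (ht0 : 0 ≤ t) (ht1 : t ≤ 1)
    (hm0 : midVal fu lam k u0 (t * (u1 - u0)) ∈ Icc uMin uMax)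
    (hm1 : midVal fu lam k u1 (s * (u1 - u0)) ∈ Icc uMin uMax) :
    cellNew f fu lam k k u0 u1 (t * (u1 - u0)) (s * (u1 - u0)) ^ 2 / 2
        - (u0 ^ 2 + u1 ^ 2) / 4
        + entropyFlux f fu uMin lam k u1 (s * (u1 - u0))
        - entropyFlux f fu uMin lam k u0 (t * (u1 - u0))
      ≤ -((1 - (s + t) / 2) * (u1 - u0) ^ 2 / 20) := by
  have hlam := h.lam_pos
  have hκ0 := h.kappa_nonneg
  have a0 := h.abs_midVal_sub_le (σ := t * (u1 - u0)) hk hu0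
  have a1 := h.abs_midVal_sub_le (σ := s * (u1 - u0)) hk hu1
  have em : midVal fu lam k u1 (s * (u1 - u0)) - midVal fu lam k u0 (t * (u1 - u0))
      = (u1 - u0) - (lam * fu k u1 * s - lam * fu k u0 * t) * (u1 - u0) / 2 := by
    simp only [midVal]; ring
  have emm : (midVal fu lam k u1 (s * (u1 - u0)) + midVal fu lam k u0 (t * (u1 - u0))) / 2
      = (u0 + u1) / 2 - (u1 - u0) * (lam * fu k u1 * s + lam * fu k u0 * t) / 4 := by
    simp only [midVal]; ring
  simp only [cellNew, entropyFlux]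
  set m0 := midVal fu lam k u0 (t * (u1 - u0))
  set m1 := midVal fu lam k u1 (s * (u1 - u0))
  set d := u1 - u0 with hd
  set p0 := lam * fu k u0 with hp0
  set p1 := lam * fu k u1 with hp1
  set E := |p1 - p0| with hE
  obtain ⟨b1, b2, b3⟩ := h.abs_fu_sub_le hk hu0 hu1
  have hEeq : E = lam * |fu k u1 - fu k u0| := by
    rw [hE, hp1, hp0, ← mul_sub, abs_mul, abs_of_pos hlam]
  -- Moving to the mid-value changes `lam * f_u` by at most `lam * γ₂ * κ / 2 * |d|`. The bound `κ *
  -- γ₂ ≤ γ₁ / 7500` and uniform convexity, `lam * γ₁ * |d| ≤ E`, make this a small fraction of `E`.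
  have hsmall : ∀ {u m r : ℝ}, u ∈ Icc uMin uMax → m ∈ Icc uMin uMax → 0 ≤ r → r ≤ 1 →
      |m - u| ≤ κ / 2 * |r * d| → |lam * fu k m - lam * fu k u| ≤ E / 15000 := by
    intro u m r hu hm hr0 hr1 hmu
    have c1 := (h.abs_fu_sub_le hk hu hm).2.1
    rw [← mul_sub, abs_mul, abs_of_pos hlam, hEeq]
    have c2 : |r * d| ≤ |d| := by
      rw [abs_mul, abs_of_nonneg hr0]; exact mul_le_of_le_one_left (abs_nonneg _) hr1
    have hγ₂ : 0 ≤ γ₂ := h.gamma_pos.le.trans h.gamma_le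
    calc lam * |fu k m - fu k u| ≤ lam * (γ₂ * (κ / 2 * |d|)) := by
          gcongr
          exact c1.trans (by gcongr; exact hmu.trans (by gcongr))
      _ = lam * (κ * γ₂ / 2 * |d|) := by ring
      _ ≤ lam * (γ₁ / 7500 / 2 * |d|) := by gcongr; exact h.kappa_gamma
      _ = lam * (γ₁ * |d|) / 15000 := by ring
      _ ≤ _ := by gcongr
  have s0 := hsmall hu0 hm0 ht0 ht1 a0
  have s1 := hsmall hu1 hm1 hs0 hs1 a1
  have hE0 : 0 ≤ E := abs_nonneg _
  have hpm : |lam * fu k m1 - lam * fu k m0| ≤ 3 / 2 * E := by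
    have e : lam * fu k m1 - lam * fu k m0
        = (lam * fu k m1 - p1) + (p1 - p0) - (lam * fu k m0 - p0) := by ring
    rw [e]
    have := abs_sub ((lam * fu k m1 - p1) + (p1 - p0)) (lam * fu k m0 - p0)
    have := abs_add_le (lam * fu k m1 - p1) (p1 - p0)
    linarith
  have hpm' : lam * |fu k m1 - fu k m0| ≤ 3 / 2 * E := by
    rwa [← mul_sub, abs_mul, abs_of_pos hlam] at hpm
  set g := lam * (f k m1 - f k m0) with hg
  have hgb : |g - p0 * (m1 - m0)| ≤ 2 * E * |m1 - m0| := by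
    have t1 := h.tangent_le k hk m0 hm0 m1 hm1
    have t2 := h.tangent_le k hk m1 hm1 m0 hm0
    have t3 : |f k m1 - f k m0 - fu k m0 * (m1 - m0)| ≤ |fu k m1 - fu k m0| * |m1 - m0| := by
      rw [← abs_mul, abs_of_nonneg (by linarith)]
      exact le_trans (by linarith) (le_abs_self _)
    have e : g - p0 * (m1 - m0) = lam * (f k m1 - f k m0 - fu k m0 * (m1 - m0))
        + (lam * fu k m0 - p0) * (m1 - m0) := by rw [hg]; ring
    rw [e]
    refine (abs_add_le _ _).trans ?_
    rw [abs_mul, abs_of_pos hlam, abs_mul (lam * fu k m0 - p0)]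
    have t4 := mul_le_mul_of_nonneg_left t3 hlam.le
    have t5 := mul_le_mul_of_nonneg_right hpm' (abs_nonneg (m1 - m0))
    have t6 := mul_le_mul_of_nonneg_right s0 (abs_nonneg (m1 - m0))
    have t7 := mul_nonneg hE0 (abs_nonneg (m1 - m0))
    linarith
  have htrap := trapezoid_sub_integral_le (h.cont k hk) (h.tangent_le k hk) hm0 hm1
  have hint : ∀ m ∈ Icc uMin uMax, IntervalIntegrable (f k) volume uMin m := fun m hm =>
    ((h.cont k hk).mono (uIcc_subset_Icc (left_mem_Icc.2 h.u_le) hm)).intervalIntegrable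
  have hsplit := intervalIntegral.integral_interval_sub_left (hint m1 hm1) (hint m0 hm0)
  rw [← hsplit] at htrap
  set I1 := ∫ y in uMin..m1, f k y
  set I0 := ∫ y in uMin..m0, f k y
  have htr : lam * ((m1 - m0) * (f k m0 + f k m1) / 2 - (I1 - I0)) ≤ 2 * E * (m1 - m0) ^ 2 := by
    have t1 := mul_le_mul_of_nonneg_left htrap hlam.le
    have t2 := mul_le_mul_of_nonneg_right hpm' (sq_nonneg (m1 - m0))
    have t3 := mul_nonneg hE0 (sq_nonneg (m1 - m0))
    linarith
  have hsign : (p1 - p0) * (d * |d|) = E * d ^ 2 := by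
    have hb : 0 ≤ (p1 - p0) * d := by
      rw [hp1, hp0, ← mul_sub, mul_assoc]; exact mul_nonneg hlam.le b3
    rw [← mul_assoc, ← abs_of_nonneg hb, abs_mul, mul_assoc, abs_mul_abs_self, sq]
  rw [em] at hgb htr
  have key := cell_algebra hκ0 h.kappa_le hs0 hs1 ht0 ht1 (h.abs_lam_fu_le hk hu0)
    (h.abs_lam_fu_le hk hu1) hE hsign hgb htr
  have hs : s * d * |s * d| = s ^ 2 * (d * |d|) := by
    rw [abs_mul, abs_of_nonneg hs0]; ring
  have ht : t * d * |t * d| = t ^ 2 * (d * |d|) := by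
    rw [abs_mul, abs_of_nonneg ht0]; ring
  rw [hs, ht]
  rw [← hp1, ← hp0] at key
  refine le_trans (le_of_eq ?_) key
  rw [← em]
  have e1 : (u0 + u1) / 2 = (m1 + m0) / 2 + d * (p1 * s + p0 * t) / 4 := by linarith
  have e2 : lam * (m1 * f k m1 - I1) - lam * (m0 * f k m0 - I0)
      = (m1 + m0) / 2 * g + lam * ((m1 - m0) * (f k m0 + f k m1) / 2 - (I1 - I0)) := by
    rw [hg]; ring
  have e3 : (m1 + m0) / 2 = (u0 + u1) / 2 - d * (p1 * s + p0 * t) / 4 := by linarith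
  rw [e3] at e2
  have e4 : u1 = u0 + d := by rw [hd]; ring
  clear_value d p0 p1 g I1 I0 m0 m1
  rw [e4] at e2 ⊢
  linear_combination e2

end FluxBounds

/-- A value `u` and a slope `σ` such that `u`, `u + σ`, `u - σ` stay in `[uMin, uMax]`. -/
structure Admissible (uMin uMax u σ : ℝ) : Prop where
  mem : u ∈ Icc uMin uMax
  add_mem : u + σ ∈ Icc uMin uMax
  sub_mem : u - σ ∈ Icc uMin uMax

theorem Admissible.abs_slope_le {u σ : ℝ} (h : Admissible uMin uMax u σ) :
    |σ| ≤ uMax - uMin := by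
  obtain ⟨h1, h2, h3⟩ := h
  rw [mem_Icc] at h1 h2 h3
  rw [abs_le]
  constructor <;> linarith

theorem abs_le_supBound {u : ℝ} (h : u ∈ Icc uMin uMax) : |u| ≤ supBound uMin uMax :=
  abs_le_max_abs_abs h.1 h.2

/-! ### Maximum principle and dependence on the coefficient. -/

namespace FluxBounds

/-- Maximum principle: the flux does not depend on `k` at the end points of the range. -/
theorem cellNew_mem (h : FluxBounds f fu kMin kMax uMin uMax γ₁ γ₂ lam κ L B)
    {k0 k1 u0 u1 σ0 σ1 : ℝ} (hk0 : k0 ∈ Icc kMin kMax) (hk1 : k1 ∈ Icc kMin kMax)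
    (h0 : Admissible uMin uMax u0 σ0) (h1 : Admissible uMin uMax u1 σ1) :
    cellNew f fu lam k0 k1 u0 u1 σ0 σ1 ∈ Icc uMin uMax := by
  have hm0 := h.midVal_mem hk0 h0.mem h0.add_mem h0.sub_mem
  have hm1 := h.midVal_mem hk1 h1.mem h1.add_mem h1.sub_mem
  have a0 := abs_le.1 (h.abs_midVal_sub_le (σ := σ0) hk0 h0.mem)
  have a1 := abs_le.1 (h.abs_midVal_sub_le (σ := σ1) hk1 h1.mem)
  have hκ0 := h.kappa_nonneg
  have hκ := h.kappa_le
  rw [cellNew]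
  set m0 := midVal fu lam k0 u0 σ0
  set m1 := midVal fu lam k1 u1 σ1
  -- Both fluxes are compared with their common value at an end point `v`, so no term in `|k1 - k0|`
  -- appears.
  have key : ∀ v ∈ Icc uMin uMax, f k0 v = f k1 v →
      |lam * (f k1 m1 - f k0 m0)| ≤ κ * |m0 - v| + κ * |m1 - v| := fun v hv hvk => by
    have e : lam * (f k1 m1 - f k0 m0) = lam * (f k1 m1 - f k1 v) - lam * (f k0 m0 - f k0 v) := by
      rw [hvk]; ring
    rw [e]
    refine (abs_sub _ _).trans ?_
    rw [abs_mul, abs_mul, abs_of_pos h.lam_pos]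
    linarith [h.lip_u hk0 hv hm0, h.lip_u hk1 hv hm1]
  have hmin : uMin ∈ Icc uMin uMax := left_mem_Icc.2 h.u_le
  have hmax : uMax ∈ Icc uMin uMax := right_mem_Icc.2 h.u_le
  have k1' := abs_le.1 (key uMin hmin (h.eq_at_min k0 hk0 k1 hk1))
  have k2' := abs_le.1 (key uMax hmax (h.eq_at_max k0 hk0 k1 hk1))
  rw [abs_of_nonneg (sub_nonneg.2 hm0.1), abs_of_nonneg (sub_nonneg.2 hm1.1)] at k1'
  rw [abs_sub_comm, abs_of_nonneg (sub_nonneg.2 hm0.2), abs_sub_comm,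
    abs_of_nonneg (sub_nonneg.2 hm1.2)] at k2'
  -- The slope and the flux each cost at most `1/8` of the distance from `u` to the bound, against
  -- the weight `1/2` of the node in the average.
  have low : ∀ {u σ m : ℝ}, Admissible uMin uMax u σ → m - u ≤ κ / 2 * |σ| →
      |σ| ≤ u - uMin ∧ κ * (m - uMin) ≤ (u - uMin) / 8 := fun {u σ m} ha hm => by
    obtain ⟨b1, b2, b3⟩ := ha
    have b : |σ| ≤ u - uMin := by rw [abs_le]; constructor <;> linarith [b2.1, b3.1]
    refine ⟨b, ?_⟩
    have c0 : 0 ≤ u - uMin := sub_nonneg.2 b1.1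
    have c1 : κ / 2 * |σ| ≤ 1 / 2 * (u - uMin) := by gcongr; linarith
    calc κ * (m - uMin) ≤ κ * (2 * (u - uMin)) := by gcongr; linarith
      _ ≤ 1 / 4000 * (2 * (u - uMin)) := by gcongr
      _ ≤ _ := by linarith
  have upp : ∀ {u σ m : ℝ}, Admissible uMin uMax u σ → -(κ / 2 * |σ|) ≤ m - u →
      |σ| ≤ uMax - u ∧ κ * (uMax - m) ≤ (uMax - u) / 8 := fun {u σ m} ha hm => by
    obtain ⟨b1, b2, b3⟩ := ha
    have b : |σ| ≤ uMax - u := by rw [abs_le]; constructor <;> linarith [b2.2, b3.2]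
    refine ⟨b, ?_⟩
    have c0 : 0 ≤ uMax - u := sub_nonneg.2 b1.2
    have c1 : κ / 2 * |σ| ≤ 1 / 2 * (uMax - u) := by gcongr; linarith
    calc κ * (uMax - m) ≤ κ * (2 * (uMax - u)) := by gcongr; linarith
      _ ≤ 1 / 4000 * (2 * (uMax - u)) := by gcongr
      _ ≤ _ := by linarith
  obtain ⟨l0, l0'⟩ := low h0 a0.2
  obtain ⟨l1, l1'⟩ := low h1 a1.2
  obtain ⟨r0, r0'⟩ := upp h0 a0.1
  obtain ⟨r1, r1'⟩ := upp h1 a1.1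
  have := le_abs_self σ0
  have := neg_le_abs σ0
  have := le_abs_self σ1
  have := neg_le_abs σ1
  constructor <;> linarith

theorem bound_nonneg (h : FluxBounds f fu kMin kMax uMin uMax γ₁ γ₂ lam κ L B) : 0 ≤ B :=
  (abs_nonneg _).trans (h.bound kMin (left_mem_Icc.2 h.k_le) uMin (left_mem_Icc.2 h.u_le))

theorem midVal_lip (h : FluxBounds f fu kMin kMax uMin uMax γ₁ γ₂ lam κ L B)
    {k k' u σ : ℝ} (hk : k ∈ Icc kMin kMax) (hk' : k' ∈ Icc kMin kMax)
    (hu : Admissible uMin uMax u σ) :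
    |midVal fu lam k u σ - midVal fu lam k' u σ|
      ≤ lam / 2 * L * (uMax - uMin) * |k - k'| := by
  have hlam := h.lam_pos
  have hL := h.L_nonneg
  have e : midVal fu lam k u σ - midVal fu lam k' u σ
      = -(lam / 2 * (fu k u - fu k' u) * σ) := by simp only [midVal]; ring
  rw [e, abs_neg, abs_mul, abs_mul, abs_of_pos (by positivity : 0 < lam / 2)]
  calc lam / 2 * |fu k u - fu k' u| * |σ| ≤ lam / 2 * (L * |k - k'|) * (uMax - uMin) := by
        gcongr
        · exact h.lip_fu k hk k' hk' u hu.mem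
        · exact hu.abs_slope_le
    _ = _ := by ring

theorem flux_midVal_lip (h : FluxBounds f fu kMin kMax uMin uMax γ₁ γ₂ lam κ L B)
    {k k' u σ : ℝ} (hk : k ∈ Icc kMin kMax) (hk' : k' ∈ Icc kMin kMax)
    (hu : Admissible uMin uMax u σ) :
    lam * |f k (midVal fu lam k u σ) - f k' (midVal fu lam k' u σ)|
      ≤ (lam * L + κ * (lam / 2 * L * (uMax - uMin))) * |k - k'| := by
  have hm := h.midVal_mem hk hu.mem hu.add_mem hu.sub_mem
  have hm' := h.midVal_mem hk' hu.mem hu.add_mem hu.sub_mem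
  have h1 := h.lip_f k hk k' hk' _ hm
  have h2 := h.lip_u hk' hm' hm
  have h3 := mul_le_mul_of_nonneg_left (h.midVal_lip hk hk' hu) h.kappa_nonneg
  have h4 := mul_le_mul_of_nonneg_left h1 h.lam_pos.le
  have h5 := mul_le_mul_of_nonneg_left (abs_sub_le (f k (midVal fu lam k u σ))
    (f k' (midVal fu lam k u σ)) (f k' (midVal fu lam k' u σ))) h.lam_pos.le
  linarith

theorem intervalIntegrable_flux (h : FluxBounds f fu kMin kMax uMin uMax γ₁ γ₂ lam κ L B)
    {k x y : ℝ} (hk : k ∈ Icc kMin kMax) (hx : x ∈ Icc uMin uMax) (hy : y ∈ Icc uMin uMax) :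
    IntervalIntegrable (f k) volume x y :=
  ((h.cont k hk).mono (uIcc_subset_Icc hx hy)).intervalIntegrable

theorem exists_entropyFlux_lip (h : FluxBounds f fu kMin kMax uMin uMax γ₁ γ₂ lam κ L B) :
    ∃ Λ, 0 ≤ Λ ∧ ∀ k ∈ Icc kMin kMax, ∀ k' ∈ Icc kMin kMax, ∀ u σ,
      Admissible uMin uMax u σ →
      |entropyFlux f fu uMin lam k u σ - entropyFlux f fu uMin lam k' u σ| ≤ Λ * |k - k'| := by
  have hlam := h.lam_pos
  have hL := h.L_nonneg
  have hκ := h.kappa_nonneg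
  have hB := h.bound_nonneg
  have hD : 0 ≤ uMax - uMin := sub_nonneg.2 h.u_le
  have hmin : uMin ∈ Icc uMin uMax := left_mem_Icc.2 h.u_le
  have hC : 0 ≤ supBound uMin uMax := (abs_nonneg _).trans (abs_le_supBound hmin)
  set D := uMax - uMin with hDdef
  set C := supBound uMin uMax
  refine ⟨lam * (lam / 2 * L * D) * B + C * (lam * L + κ * (lam / 2 * L * D))
    + lam * (L * D + B * (lam / 2 * L * D)) + 4 * lam * L * (D * D), by positivity, ?_⟩
  intro k hk k' hk' u σ hu
  have hm := h.midVal_mem hk hu.mem hu.add_mem hu.sub_mem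
  have hm' := h.midVal_mem hk' hu.mem hu.add_mem hu.sub_mem
  have hml := h.midVal_lip hk hk' hu
  have hfl := h.flux_midVal_lip hk hk' hu
  simp only [entropyFlux]
  set m := midVal fu lam k u σ
  set m' := midVal fu lam k' u σ
  have e : (∫ y in uMin..m, f k y) - ∫ y in uMin..m', f k' y
      = (∫ y in uMin..m, (f k y - f k' y)) + ∫ y in m'..m, f k' y := by
    rw [intervalIntegral.integral_sub (h.intervalIntegrable_flux hk hmin hm)
      (h.intervalIntegrable_flux hk' hmin hm),
      ← intervalIntegral.integral_interval_sub_left (h.intervalIntegrable_flux hk' hmin hm)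
        (h.intervalIntegrable_flux hk' hmin hm')]
    ring
  have i1 : |∫ y in uMin..m, (f k y - f k' y)| ≤ L * |k - k'| * D := by
    have := intervalIntegral.norm_integral_le_of_norm_le_const (a := uMin) (b := m)
      (f := fun y => f k y - f k' y) (C := L * |k - k'|) fun y hy => by
        rw [uIoc_of_le hm.1] at hy
        exact h.lip_f k hk k' hk' y ⟨hy.1.le, hy.2.trans hm.2⟩
    rw [Real.norm_eq_abs, abs_of_nonneg (sub_nonneg.2 hm.1)] at this
    refine this.trans ?_
    have := hm.2
    gcongr
    linarith
  have i2 : |∫ y in m'..m, f k' y| ≤ B * (lam / 2 * L * D * |k - k'|) := by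
    have := intervalIntegral.norm_integral_le_of_norm_le_const (a := m') (b := m)
      (f := fun y => f k' y) (C := B) fun y hy =>
        h.bound k' hk' y (uIcc_subset_Icc hm' hm (uIoc_subset_uIcc hy))
    rw [Real.norm_eq_abs] at this
    exact this.trans (by gcongr)
  have i3 : |(∫ y in uMin..m, f k y) - ∫ y in uMin..m', f k' y|
      ≤ (L * D + B * (lam / 2 * L * D)) * |k - k'| := by
    rw [e]
    refine (abs_add_le _ _).trans ?_
    linarith
  have i4 : |lam * (m * f k m - m' * f k' m')|
      ≤ (lam * (lam / 2 * L * D) * B + C * (lam * L + κ * (lam / 2 * L * D))) * |k - k'| := by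
    have e2 : lam * (m * f k m - m' * f k' m')
        = lam * (m - m') * f k m + m' * (lam * (f k m - f k' m')) := by ring
    rw [e2]
    refine (abs_add_le _ _).trans ?_
    rw [abs_mul, abs_mul, abs_mul m', abs_mul lam, abs_of_pos hlam]
    have j1 : lam * |m - m'| * |f k m| ≤ lam * (lam / 2 * L * D * |k - k'|) * B := by
      gcongr
      exact h.bound k hk m hm
    have j2 : |m'| * (lam * |f k m - f k' m'|)
        ≤ C * ((lam * L + κ * (lam / 2 * L * D)) * |k - k'|) := by
      gcongr
      exact abs_le_supBound hm'
    linarith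
  have i5 : |4 * (lam * (fu k u - fu k' u)) * (σ * |σ|)| ≤ 4 * lam * L * (D * D) * |k - k'| := by
    rw [abs_mul, abs_mul, abs_mul lam, abs_mul σ, abs_abs, abs_of_pos hlam,
      abs_of_pos (by norm_num : (0 : ℝ) < 4)]
    have j1 := hu.abs_slope_le
    calc 4 * (lam * |fu k u - fu k' u|) * (|σ| * |σ|) ≤ 4 * (lam * (L * |k - k'|)) * (D * D) := by
          gcongr
          exact h.lip_fu k hk k' hk' u hu.mem
      _ = _ := by ring
  have e3 : u * σ / 8 + lam * (m * f k m - ∫ y in uMin..m, f k y) - 4 * (lam * fu k u) * (σ * |σ|)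
      - (u * σ / 8 + lam * (m' * f k' m' - ∫ y in uMin..m', f k' y)
        - 4 * (lam * fu k' u) * (σ * |σ|))
      = lam * (m * f k m - m' * f k' m')
        - lam * ((∫ y in uMin..m, f k y) - ∫ y in uMin..m', f k' y)
        - 4 * (lam * (fu k u - fu k' u)) * (σ * |σ|) := by ring
  rw [e3]
  refine (abs_sub _ _).trans ((add_le_add_left (abs_sub _ _) _).trans ?_)
  rw [abs_mul lam ((∫ y in uMin..m, f k y) - _), abs_of_pos hlam]
  have := mul_le_mul_of_nonneg_left i3 hlam.le
  linarith

theorem exists_entropyFlux_bound (h : FluxBounds f fu kMin kMax uMin uMax γ₁ γ₂ lam κ L B) :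
    ∃ Λ, 0 ≤ Λ ∧ ∀ k ∈ Icc kMin kMax, ∀ u σ, Admissible uMin uMax u σ →
      |entropyFlux f fu uMin lam k u σ| ≤ Λ := by
  have hlam := h.lam_pos
  have hκ := h.kappa_nonneg
  have hB := h.bound_nonneg
  have hD : 0 ≤ uMax - uMin := sub_nonneg.2 h.u_le
  have hmin : uMin ∈ Icc uMin uMax := left_mem_Icc.2 h.u_le
  have hC : 0 ≤ supBound uMin uMax := (abs_nonneg _).trans (abs_le_supBound hmin)
  set D := uMax - uMin with hDdef
  set C := supBound uMin uMax
  refine ⟨C * D / 8 + lam * (C * B + B * D) + 4 * κ * (D * D), by positivity,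
    fun k hk u σ hu => ?_⟩
  have hm := h.midVal_mem hk hu.mem hu.add_mem hu.sub_mem
  simp only [entropyFlux]
  set m := midVal fu lam k u σ
  have j0 := hu.abs_slope_le
  have j1 : |u * σ / 8| ≤ C * D / 8 := by
    rw [abs_div, abs_mul, abs_of_pos (by norm_num : (0 : ℝ) < 8)]
    gcongr
    exact abs_le_supBound hu.mem
  have j2 : |∫ y in uMin..m, f k y| ≤ B * D := by
    have := intervalIntegral.norm_integral_le_of_norm_le_const (a := uMin) (b := m)
      (f := fun y => f k y) (C := B) fun y hy =>
        h.bound k hk y (uIcc_subset_Icc hmin hm (uIoc_subset_uIcc hy))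
    rw [Real.norm_eq_abs, abs_of_nonneg (sub_nonneg.2 hm.1)] at this
    refine this.trans ?_
    have := hm.2
    gcongr
    linarith
  have j3 : |m * f k m| ≤ C * B := by
    rw [abs_mul]
    gcongr
    · exact abs_le_supBound hm
    · exact h.bound k hk m hm
  have j4 : |4 * (lam * fu k u) * (σ * |σ|)| ≤ 4 * κ * (D * D) := by
    rw [abs_mul, abs_mul 4, abs_mul σ, abs_abs, abs_of_pos (by norm_num : (0 : ℝ) < 4)]
    gcongr
    exact h.abs_lam_fu_le hk hu.mem
  have j5 : |lam * (m * f k m - ∫ y in uMin..m, f k y)| ≤ lam * (C * B + B * D) := by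
    rw [abs_mul, abs_of_pos hlam]
    gcongr
    exact (abs_sub _ _).trans (add_le_add j3 j2)
  refine (abs_sub _ _).trans ((add_le_add_left (abs_add_le _ _) _).trans ?_)
  linarith

/-- The cell energy inequality; the variation of the coefficient enters linearly. -/
theorem exists_cell_energy (h : FluxBounds f fu kMin kMax uMin uMax γ₁ γ₂ lam κ L B) :
    ∃ Λ, 0 ≤ Λ ∧ ∀ k0 ∈ Icc kMin kMax, ∀ k1 ∈ Icc kMin kMax, ∀ u0 u1 s t : ℝ,
      0 ≤ s → s ≤ 1 → 0 ≤ t → t ≤ 1 →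
      Admissible uMin uMax u0 (t * (u1 - u0)) → Admissible uMin uMax u1 (s * (u1 - u0)) →
      cellNew f fu lam k0 k1 u0 u1 (t * (u1 - u0)) (s * (u1 - u0)) ^ 2 / 2
        - (u0 ^ 2 + u1 ^ 2) / 4
        + entropyFlux f fu uMin lam k1 u1 (s * (u1 - u0))
        - entropyFlux f fu uMin lam k0 u0 (t * (u1 - u0))
      ≤ -((1 - (s + t) / 2) * (u1 - u0) ^ 2 / 20) + Λ * |k1 - k0| := by
  obtain ⟨Λ, hΛ0, hΛ⟩ := h.exists_entropyFlux_lip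
  have hlam := h.lam_pos
  have hL := h.L_nonneg
  have hκ := h.kappa_nonneg
  have hD : 0 ≤ uMax - uMin := sub_nonneg.2 h.u_le
  have hmin : uMin ∈ Icc uMin uMax := left_mem_Icc.2 h.u_le
  have hC : 0 ≤ supBound uMin uMax := (abs_nonneg _).trans (abs_le_supBound hmin)
  refine ⟨Λ + supBound uMin uMax * (lam * L + κ * (lam / 2 * L * (uMax - uMin))),
    by positivity, fun k0 hk0 k1 hk1 u0 u1 s t hs0 hs1 ht0 ht1 h0 h1 => ?_⟩
  have hm0 := h.midVal_mem hk0 h0.mem h0.add_mem h0.sub_mem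
  have hm1 := h.midVal_mem hk0 h1.mem h1.add_mem h1.sub_mem
  -- The coefficient is frozen at `k0`; restoring `k1` at the right node alters only that entropy
  -- flux and the new value.
  have key := h.cell_energy_of_eq hk0 h0.mem h1.mem hs0 hs1 ht0 ht1 hm0 hm1
  have hQ := le_of_abs_le (hΛ k1 hk1 k0 hk0 _ _ h1)
  have hV := abs_le_supBound (h.cellNew_mem hk0 hk1 h0 h1)
  have hV' := abs_le_supBound (h.cellNew_mem hk0 hk0 h0 h1)
  have hf := h.flux_midVal_lip hk1 hk0 h1
  set V := cellNew f fu lam k0 k1 u0 u1 (t * (u1 - u0)) (s * (u1 - u0)) with hVd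
  set V' := cellNew f fu lam k0 k0 u0 u1 (t * (u1 - u0)) (s * (u1 - u0)) with hVd'
  have hVV : |V - V'| ≤ (lam * L + κ * (lam / 2 * L * (uMax - uMin))) * |k1 - k0| := by
    refine le_trans (le_of_eq ?_) hf
    rw [← abs_of_pos hlam, ← abs_mul, abs_of_pos hlam, ← abs_neg, hVd, hVd', cellNew, cellNew]
    congr 1
    ring
  have hsq : V ^ 2 / 2 - V' ^ 2 / 2
      ≤ supBound uMin uMax * ((lam * L + κ * (lam / 2 * L * (uMax - uMin))) * |k1 - k0|) := by
    have e : V ^ 2 / 2 - V' ^ 2 / 2 = (V + V') / 2 * (V - V') := by ring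
    rw [e]
    refine (le_abs_self _).trans ?_
    rw [abs_mul]
    gcongr
    rw [abs_div, abs_two]
    linarith [abs_add_le V V']
  linarith

end FluxBounds

end Energy

/-! ### Slopes and weights -/

/-- All that the argument uses of the limiter: a slope is a fraction in `[0, 1]` of each
neighbouring increment. -/
theorem minmod_eq_mul (a b c : ℝ) :
    (∃ τ, 0 ≤ τ ∧ τ ≤ 1 ∧ minmod a b c = τ * a) ∧ ∃ τ, 0 ≤ τ ∧ τ ≤ 1 ∧ minmod a b c = τ * c := by
  by_cases hs : Real.sign a = Real.sign b ∧ Real.sign b = Real.sign c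
  · have aux : ∀ x m : ℝ, 0 ≤ m → m ≤ |x| → ∃ τ, 0 ≤ τ ∧ τ ≤ 1 ∧ Real.sign x * m = τ * x := by
      intro x m hm0 hm
      rcases eq_or_ne x 0 with rfl | hx
      · exact ⟨0, le_rfl, zero_le_one, by simp⟩
      · have hpos : 0 < |x| := abs_pos.2 hx
        refine ⟨m / |x|, by positivity, (div_le_one hpos).2 hm, ?_⟩
        rcases hx.lt_or_gt with h | h
        · rw [Real.sign_of_neg h, abs_of_neg h]; field_simp
        · rw [Real.sign_of_pos h, abs_of_pos h]; field_simp
    have h0 : 0 ≤ min |a| (min |b| |c|) := by positivity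
    rw [minmod, if_pos hs]
    refine ⟨aux _ _ h0 (min_le_left _ _), ?_⟩
    rw [hs.1, hs.2]
    exact aux _ _ h0 ((min_le_right _ _).trans (min_le_right _ _))
  · rw [minmod, if_neg hs]
    exact ⟨⟨0, le_rfl, zero_le_one, by simp⟩, ⟨0, le_rfl, zero_le_one, by simp⟩⟩

theorem slope_eq_mul_diff (v : ℤ → ℝ) (j : ℤ) :
    ∃ τ, 0 ≤ τ ∧ τ ≤ 1 ∧ slope v j = τ * diff v j :=
  (minmod_eq_mul _ _ _).1

theorem slope_succ_eq_mul_diff (v : ℤ → ℝ) (j : ℤ) :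
    ∃ τ, 0 ≤ τ ∧ τ ≤ 1 ∧ slope v (j + 1) = τ * diff v j := by
  have := (minmod_eq_mul (v (j + 1 + 1) - v (j + 1)) ((v (j + 1 + 1) - v (j + 1 - 1)) / 2)
    (v (j + 1) - v (j + 1 - 1))).2
  rw [add_sub_cancel_right] at this
  rw [slope, add_sub_cancel_right]
  exact this

theorem admissible_slope {uMin uMax : ℝ} {v : ℤ → ℝ} (hv : ∀ j, v j ∈ Icc uMin uMax) (j : ℤ) :
    Admissible uMin uMax (v j) (slope v j) := by
  refine ⟨hv j, ?_, ?_⟩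
  · obtain ⟨τ, h0, h1, h⟩ := slope_eq_mul_diff v j
    rw [h, diff, show v j + τ * (v (j + 1) - v j) = (1 - τ) * v j + τ * v (j + 1) by ring]
    exact convex_Icc uMin uMax (hv j) (hv (j + 1)) (sub_nonneg.2 h1) h0 (by ring)
  · obtain ⟨τ, h0, h1, h⟩ := slope_succ_eq_mul_diff v (j - 1)
    rw [sub_add_cancel] at h
    rw [h, diff, sub_add_cancel,
      show v j - τ * (v j - v (j - 1)) = (1 - τ) * v j + τ * v (j - 1) by ring]
    exact convex_Icc uMin uMax (hv j) (hv (j - 1)) (sub_nonneg.2 h1) h0 (by ring)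

/-- The part of the squared increment that is not recovered by the slopes. -/
def dissipation (v : ℤ → ℝ) (j : ℤ) : ℝ :=
  diff v j ^ 2 - (slope v (j + 1) + slope v j) * diff v j / 2

/-- With `w = 1 - (s + t) / 2`, both `|s - t|` and `(s - t) ^ 2` are at most `2 * w`, so every term
is a multiple of `w` and the leading one dominates. -/
theorem bracket_bounds {β s t : ℝ} (hβ : |β| ≤ 1 / 4000) (hs0 : 0 ≤ s) (hs1 : s ≤ 1)
    (ht0 : 0 ≤ t) (ht1 : t ≤ 1) :
    0 ≤ 1 - 1 / 16 * (1 - 4 * β ^ 2) * (s - t) ^ 2 - β * (s - t) - (s + t) / 2 ∧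
      1 - 1 / 16 * (1 - 4 * β ^ 2) * (s - t) ^ 2 - β * (s - t) - (s + t) / 2
        ≤ 2 * (1 - (s + t) / 2) := by
  have hx : |s - t| ≤ 2 * (1 - (s + t) / 2) := by rw [abs_le]; constructor <;> linarith
  have hx1 : |s - t| ≤ 1 := by rw [abs_le]; constructor <;> linarith
  have h1 : |β * (s - t)| ≤ 1 / 4000 * (2 * (1 - (s + t) / 2)) := by
    rw [abs_mul]; gcongr
  have h2 : (s - t) ^ 2 ≤ 2 * (1 - (s + t) / 2) := by
    rw [← sq_abs]; nlinarith [abs_nonneg (s - t)]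
  have h3 := abs_le.1 h1
  have h4 : β ^ 2 ≤ (1 / 4000) ^ 2 := by rw [← sq_abs]; gcongr
  have h5 : 0 ≤ (1 - 4 * β ^ 2) * (s - t) ^ 2 := mul_nonneg (by norm_num at h4; linarith)
    (sq_nonneg _)
  have h6 : (1 - 4 * β ^ 2) * (s - t) ^ 2 ≤ 1 * (s - t) ^ 2 :=
    mul_le_mul_of_nonneg_right (by linarith [sq_nonneg β]) (sq_nonneg _)
  constructor <;> linarith

theorem weight_bounds {f : ℝ → ℝ → ℝ} {uMin uMax lam kMid γ₂ : ℝ} {kk v : ℤ → ℝ} {j : ℤ}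
    (hβ : |beta f uMin uMax lam kk v j| ≤ 1 / 4000)
    (h0 : 0 ≤ fluxUU f uMin uMax kMid ((v j + v (j + 1)) / 2))
    (h2 : fluxUU f uMin uMax kMid ((v j + v (j + 1)) / 2) ≤ γ₂) :
    0 ≤ weight f uMin uMax lam kk v kMid j ∧
      weight f uMin uMax lam kk v kMid j * diff v j ^ 2 ≤ γ₂ / 4 * dissipation v j := by
  obtain ⟨t, ht0, ht1, ht⟩ := slope_eq_mul_diff v j
  obtain ⟨s, hs0, hs1, hs⟩ := slope_succ_eq_mul_diff v j
  have hΔ : diff (slope v) j = (s - t) * diff v j := by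
    rw [diff, hs, ht]; ring
  rw [weight, dissipation, hΔ, hs, ht]
  set β := beta f uMin uMax lam kk v j
  set F := fluxUU f uMin uMax kMid ((v j + v (j + 1)) / 2)
  set d := diff v j
  have h4 : β ^ 2 ≤ (1 / 4000) ^ 2 := by rw [← sq_abs]; gcongr
  have h5 : 0 ≤ 1 - 4 * β ^ 2 := by norm_num at h4; linarith
  -- For `d = 0` the convention `x / 0 = 0` reduces the bracket to `1`.
  rcases eq_or_ne d 0 with hd | hd
  · rw [hd]
    refine ⟨?_, by simp⟩
    simp only [mul_zero, div_zero, add_zero]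
    have : (0 : ℝ) ≤ 1 - 1 / 16 * (1 - 4 * β ^ 2) * 0 ^ 2 - 0 - 0 := by norm_num
    positivity
  · have e1 : (s - t) * d / d = s - t := by field_simp
    have e2 : (s * d + t * d) / (2 * d) = (s + t) / 2 := by field_simp
    rw [e1, e2]
    obtain ⟨b0, b1⟩ := bracket_bounds hβ hs0 hs1 ht0 ht1
    set b := 1 - 1 / 16 * (1 - 4 * β ^ 2) * (s - t) ^ 2 - β * (s - t) - (s + t) / 2
    refine ⟨by positivity, ?_⟩
    have hγ : 0 ≤ γ₂ := h0.trans h2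
    have h6 : 1 - 4 * β ^ 2 ≤ 1 := by linarith [sq_nonneg β]
    have hw : 0 ≤ 1 - (s + t) / 2 := by linarith
    calc 1 / 8 * (1 - 4 * β ^ 2) * b * F * d ^ 2
        ≤ 1 / 8 * 1 * (2 * (1 - (s + t) / 2)) * γ₂ * d ^ 2 := by gcongr
      _ = _ := by ring

/-! ### Averages of functions of bounded variation -/

/-- Jordan decomposition with globally bounded parts. Averaging preserves monotonicity and bounds,
so variations of cell averages telescope. -/
theorem HasBV.exists_monotone_sub {w : ℝ → ℝ} (hw : HasBV w) :
    ∃ (p q : ℝ → ℝ) (R : ℝ), Monotone p ∧ Monotone q ∧ (∀ x, |p x| ≤ R) ∧ (∀ x, |q x| ≤ R) ∧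
      w =ᵐ[volume] fun x => p x - q x := by
  obtain ⟨v, hwv, hv⟩ := hw
  have hl := hv.locallyBoundedVariationOn
  set V := (eVariationOn v univ).toReal
  have hp : ∀ x, |variationOnFromTo v univ 0 x| ≤ V := by
    have aux : ∀ a b, (eVariationOn v (univ ∩ Icc a b)).toReal ≤ V := fun a b =>
      ENNReal.toReal_mono hv (eVariationOn.mono v inter_subset_left)
    intro x
    rw [variationOnFromTo]
    split_ifs
    · rw [abs_of_nonneg ENNReal.toReal_nonneg]; exact aux _ _
    · rw [abs_neg, abs_of_nonneg ENNReal.toReal_nonneg]; exact aux _ _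
  have hvb : ∀ x, |v x| ≤ V + |v 0| := fun x => by
    have h1 := hv.dist_le (mem_univ x) (mem_univ 0)
    rw [Real.dist_eq] at h1
    have h2 := abs_add_le (v x - v 0) (v 0)
    rw [sub_add_cancel] at h2
    linarith
  refine ⟨variationOnFromTo v univ 0, fun x => variationOnFromTo v univ 0 x - v x,
    V + (V + |v 0|), fun x y hxy => variationOnFromTo.monotoneOn hl (mem_univ 0) (mem_univ x)
      (mem_univ y) hxy, fun x y hxy => variationOnFromTo.sub_self_monotoneOn hl (mem_univ 0)
      (mem_univ x) (mem_univ y) hxy, fun x => ?_, fun x => ?_, ?_⟩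
  · have := (abs_nonneg _).trans (hvb x)
    linarith [hp x]
  · exact (abs_sub _ _).trans (add_le_add (hp x) (hvb x))
  · filter_upwards [hwv] with x hx
    rw [hx]; ring

theorem HasBV.intervalIntegrable {w : ℝ → ℝ} (hw : HasBV w) (a b : ℝ) :
    IntervalIntegrable w volume a b := by
  obtain ⟨p, q, R, hp, hq, -, -, he⟩ := hw.exists_monotone_sub
  exact (hp.intervalIntegrable.sub hq.intervalIntegrable).congr_ae
    (ae_restrict_of_ae he.symm)

theorem cell_le {dx : ℝ} (hdx : 0 < dx) (p : ℝ) : (p - 1 / 2) * dx ≤ (p + 1 / 2) * dx := by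
  gcongr; linarith

theorem HasBV.cellAvg_mem {w : ℝ → ℝ} (hw : HasBV w) {a b : ℝ}
    (hm : ∀ᵐ x ∂(volume : Measure ℝ), w x ∈ Icc a b) {dx : ℝ} (hdx : 0 < dx) (p : ℝ) :
    cellAvg w dx p ∈ Icc a b := by
  have hle := cell_le hdx p
  have hlen : (p + 1 / 2) * dx - (p - 1 / 2) * dx = dx := by ring
  have h1 := intervalIntegral.integral_mono_ae hle
    (intervalIntegrable_const (c := a)) (hw.intervalIntegrable _ _)
    (by filter_upwards [hm] with x hx using hx.1)
  have h2 := intervalIntegral.integral_mono_ae hle (hw.intervalIntegrable _ _)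
    (intervalIntegrable_const (c := b))
    (by filter_upwards [hm] with x hx using hx.2)
  rw [intervalIntegral.integral_const, hlen, smul_eq_mul] at h1 h2
  rw [cellAvg, one_div, inv_mul_eq_div]
  exact ⟨by rw [le_div_iff₀ hdx]; linarith, by rw [div_le_iff₀ hdx]; linarith⟩

theorem cellAvg_monotone {w : ℝ → ℝ} (hw : Monotone w) {dx : ℝ} (hdx : 0 < dx) (p : ℝ) :
    cellAvg w dx p ≤ cellAvg w dx (p + 1) := by
  have hle := cell_le hdx p
  have e : ∫ x in ((p + 1 - 1 / 2) * dx)..((p + 1 + 1 / 2) * dx), w x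
      = ∫ x in ((p - 1 / 2) * dx)..((p + 1 / 2) * dx), w (x + dx) := by
    rw [intervalIntegral.integral_comp_add_right]
    congr 1 <;> ring
  rw [cellAvg, cellAvg, e]
  refine mul_le_mul_of_nonneg_left ?_ (by positivity)
  have hs : Monotone fun x => w (x + dx) := fun x y hxy => hw (by linarith)
  exact intervalIntegral.integral_mono_on hle hw.intervalIntegrable hs.intervalIntegrable
    fun x _ => hw (by linarith)

theorem abs_cellAvg_le {w : ℝ → ℝ} {R : ℝ} (hw : ∀ x, |w x| ≤ R) {dx : ℝ} (hdx : 0 < dx)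
    (p : ℝ) : |cellAvg w dx p| ≤ R := by
  have h := intervalIntegral.norm_integral_le_of_norm_le_const (f := w)
    (a := (p - 1 / 2) * dx) (b := (p + 1 / 2) * dx) fun x _ => hw x
  rw [show (p + 1 / 2) * dx - (p - 1 / 2) * dx = dx by ring, abs_of_pos hdx,
    Real.norm_eq_abs] at h
  rw [cellAvg, one_div, inv_mul_eq_div, abs_div, abs_of_pos hdx, div_le_iff₀ hdx]
  exact h

/-- The total variation of the cell averages is bounded uniformly in the mesh size. -/
theorem HasBV.exists_cellAvg_variation {w : ℝ → ℝ} (hw : HasBV w) :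
    ∃ R, 0 ≤ R ∧ ∀ dx, 0 < dx → ∀ (a : ℝ) (j₀ : ℤ) (M : ℕ),
      ∑ i ∈ Finset.range M, |cellAvg w dx (((j₀ + i + 1 : ℤ) : ℝ) + a)
        - cellAvg w dx (((j₀ + i : ℤ) : ℝ) + a)| ≤ R := by
  obtain ⟨p, q, R, hp, hq, hpR, hqR, he⟩ := hw.exists_monotone_sub
  have hR : 0 ≤ R := (abs_nonneg _).trans (hpR 0)
  -- Each of the two monotone parts ranges in `[-R, R]` and contributes at most `2 * R`.
  refine ⟨4 * R, by positivity, fun dx hdx a j₀ M => ?_⟩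
  have hsub : ∀ x, cellAvg w dx x = cellAvg p dx x - cellAvg q dx x := fun x => by
    rw [cellAvg, cellAvg, cellAvg, ← mul_sub,
      ← intervalIntegral.integral_sub hp.intervalIntegrable hq.intervalIntegrable]
    congr 1
    exact intervalIntegral.integral_congr_ae (by filter_upwards [he] with x hx _ using hx)
  set P : ℕ → ℝ := fun i => cellAvg p dx (((j₀ + i : ℤ) : ℝ) + a)
  set Q : ℕ → ℝ := fun i => cellAvg q dx (((j₀ + i : ℤ) : ℝ) + a)
  have hcast : ∀ i : ℕ, ((j₀ + i + 1 : ℤ) : ℝ) + a = ((j₀ + i : ℤ) : ℝ) + a + 1 := fun i => by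
    push_cast; ring
  have hcast' : ∀ i : ℕ, ((j₀ + i + 1 : ℤ) : ℝ) + a = ((j₀ + (i + 1 : ℕ) : ℤ) : ℝ) + a :=
    fun i => by push_cast; ring
  have hterm : ∀ i ∈ Finset.range M, |cellAvg w dx (((j₀ + i + 1 : ℤ) : ℝ) + a)
        - cellAvg w dx (((j₀ + i : ℤ) : ℝ) + a)| ≤ (P (i + 1) - P i) + (Q (i + 1) - Q i) := by
    intro i _
    have h1 := cellAvg_monotone hp hdx (((j₀ + i : ℤ) : ℝ) + a)
    have h2 := cellAvg_monotone hq hdx (((j₀ + i : ℤ) : ℝ) + a)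
    rw [← hcast i, hcast' i] at h1 h2
    rw [hsub, hsub, hcast' i, abs_le]
    constructor <;> simp only [P, Q] <;> linarith
  refine (Finset.sum_le_sum hterm).trans ?_
  rw [Finset.sum_add_distrib, Finset.sum_range_sub, Finset.sum_range_sub]
  have b1 := abs_le.1 (abs_cellAvg_le hpR hdx (((j₀ + M : ℤ) : ℝ) + a))
  have b2 := abs_le.1 (abs_cellAvg_le hpR hdx (((j₀ + (0 : ℕ) : ℤ) : ℝ) + a))
  have b3 := abs_le.1 (abs_cellAvg_le hqR hdx (((j₀ + M : ℤ) : ℝ) + a))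
  have b4 := abs_le.1 (abs_cellAvg_le hqR hdx (((j₀ + (0 : ℕ) : ℤ) : ℝ) + a))
  simp only [P, Q]
  linarith

/-! ### Summation of the energy inequality -/

/-- Summation by parts moves the difference onto `a`, so `y` need only be bounded. -/
theorem abs_sum_mul_sub_le {a y : ℕ → ℝ} {C Y R : ℝ} (M : ℕ) (ha : ∀ i, |a i| ≤ C)
    (hy : ∀ i, |y i| ≤ Y) (hR : ∑ i ∈ Finset.range M, |a (i + 1) - a i| ≤ R) :
    |∑ i ∈ Finset.range M, a i * (y (i + 1) - y i)| ≤ 2 * C * Y + Y * R := by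
  have hY : 0 ≤ Y := (abs_nonneg _).trans (hy 0)
  have hC : 0 ≤ C := (abs_nonneg _).trans (ha 0)
  have e : ∑ i ∈ Finset.range M, a i * (y (i + 1) - y i)
      = (a M * y M - a 0 * y 0) - ∑ i ∈ Finset.range M, y (i + 1) * (a (i + 1) - a i) := by
    rw [← Finset.sum_range_sub (fun i => a i * y i), ← Finset.sum_sub_distrib]
    exact Finset.sum_congr rfl fun i _ => by ring
  have h1 : |∑ i ∈ Finset.range M, y (i + 1) * (a (i + 1) - a i)| ≤ Y * R := by
    refine (Finset.abs_sum_le_sum_abs _ _).trans ?_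
    calc _ ≤ ∑ i ∈ Finset.range M, Y * |a (i + 1) - a i| := Finset.sum_le_sum fun i _ => by
            rw [abs_mul]; gcongr; exact hy _
      _ = Y * ∑ i ∈ Finset.range M, |a (i + 1) - a i| := by rw [Finset.mul_sum]
      _ ≤ _ := by gcongr
  have h2 : ∀ i, |a i * y i| ≤ C * Y := fun i => by
    rw [abs_mul]; gcongr
    · exact ha i
    · exact hy i
  rw [e]
  refine (abs_sub _ _).trans ?_
  have := abs_sub (a M * y M) (a 0 * y 0)
  linarith [h2 M, h2 0]

/-- A cell energy inequality for a scheme in conservation form bounds the total dissipation by the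
number of time steps. -/
theorem sum_dissipation_le {U K Q Y D : ℕ → ℕ → ℝ} {Λ C BQ BY RK RU : ℝ} (M N : ℕ)
    (hΛ : 0 ≤ Λ)
    (hE : ∀ n i, U (n + 1) i ^ 2 / 2 - (U n i ^ 2 + U n (i + 1) ^ 2) / 4 + Q n (i + 1) - Q n i
      ≤ -(D n i / 20) + Λ * |K n (i + 1) - K n i|)
    (hY : ∀ n i, U (n + 1) i - U n i = Y n (i + 1) - Y n i)
    (hU : ∀ n i, |U n i| ≤ C) (hQ : ∀ n i, |Q n i| ≤ BQ) (hYb : ∀ n i, |Y n i| ≤ BY)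
    (hK : ∀ n, ∑ i ∈ Finset.range M, |K n (i + 1) - K n i| ≤ RK)
    (hU0 : ∑ i ∈ Finset.range M, |U 0 (i + 1) - U 0 i| ≤ RU) :
    ∑ n ∈ Finset.range N, ∑ i ∈ Finset.range M, D n i
      ≤ N * (20 * (C ^ 2 / 4 + 2 * BQ + Λ * RK + (2 * C * BY + BY * RU))) := by
  set S : ℕ → ℝ := fun n => ∑ i ∈ Finset.range M, U n i ^ 2 / 2 with hS
  have hsq : ∀ n i, U n i ^ 2 ≤ C ^ 2 := fun n i => by
    rw [← sq_abs]
    have := hU n i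
    gcongr
  have step : ∀ n, (∑ i ∈ Finset.range M, D n i) / 20
      ≤ S n - S (n + 1) + (C ^ 2 / 4 + 2 * BQ + Λ * RK) := fun n => by
    have h1 := Finset.sum_le_sum fun i (_ : i ∈ Finset.range M) => hE n i
    -- Writing `(U i ^ 2 + U (i + 1) ^ 2) / 4` as `U i ^ 2 / 2` plus an increment of `U ^ 2 / 4`
    -- leaves only boundary terms besides the energies.
    have e1 : ∑ i ∈ Finset.range M,
        (U (n + 1) i ^ 2 / 2 - (U n i ^ 2 + U n (i + 1) ^ 2) / 4 + Q n (i + 1) - Q n i)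
        = S (n + 1) - S n - (U n M ^ 2 / 4 - U n 0 ^ 2 / 4) + (Q n M - Q n 0) := by
      rw [← Finset.sum_range_sub (fun i => U n i ^ 2 / 4), ← Finset.sum_range_sub (Q n), hS,
        ← Finset.sum_sub_distrib, ← Finset.sum_sub_distrib, ← Finset.sum_add_distrib]
      exact Finset.sum_congr rfl fun i _ => by ring
    have e2 : ∑ i ∈ Finset.range M, (-(D n i / 20) + Λ * |K n (i + 1) - K n i|)
        = -((∑ i ∈ Finset.range M, D n i) / 20)
          + Λ * ∑ i ∈ Finset.range M, |K n (i + 1) - K n i| := by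
      rw [Finset.sum_add_distrib, Finset.sum_neg_distrib, Finset.sum_div, Finset.mul_sum]
    rw [e1, e2] at h1
    have h2 := mul_le_mul_of_nonneg_left (hK n) hΛ
    have h3 := abs_le.1 (hQ n M)
    have h4 := abs_le.1 (hQ n 0)
    have h5 := hsq n M
    have h6 := sq_nonneg (U n 0)
    linarith
  have htel : ∀ i, ∑ n ∈ Finset.range N, (Y n (i + 1) - Y n i) = U N i - U 0 i := fun i => by
    rw [← Finset.sum_range_sub (fun n => U n i)]
    exact Finset.sum_congr rfl fun n _ => (hY n i).symm
  have hends : S 0 - S N ≤ N * (2 * C * BY + BY * RU) := by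
    -- Convexity of the square. The trivial bound on `S 0 - S N` would grow with the window length
    -- `M`.
    have h1 : S 0 - S N ≤ -∑ i ∈ Finset.range M, U 0 i * (U N i - U 0 i) := by
      rw [hS, ← Finset.sum_sub_distrib, ← Finset.sum_neg_distrib]
      exact Finset.sum_le_sum fun i _ => by nlinarith [sq_nonneg (U N i - U 0 i)]
    have h2 : ∑ i ∈ Finset.range M, U 0 i * (U N i - U 0 i)
        = ∑ n ∈ Finset.range N, ∑ i ∈ Finset.range M, U 0 i * (Y n (i + 1) - Y n i) := by
      -- After exchanging the sums, each time level is a sum of flux increments against the fixed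
      -- initial data.
      rw [Finset.sum_comm]
      exact Finset.sum_congr rfl fun i _ => by rw [← htel i, Finset.mul_sum]
    have h3 : ∑ n ∈ Finset.range N, -∑ i ∈ Finset.range M, U 0 i * (Y n (i + 1) - Y n i)
        ≤ ∑ _n ∈ Finset.range N, (2 * C * BY + BY * RU) := Finset.sum_le_sum fun n _ =>
      (neg_le_abs _).trans (abs_sum_mul_sub_le M (hU 0) (hYb n) hU0)
    rw [Finset.sum_const, Finset.card_range, nsmul_eq_mul, Finset.sum_neg_distrib] at h3
    linarith
  have h1 := Finset.sum_le_sum fun n (_ : n ∈ Finset.range N) => step n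
  rw [← Finset.sum_div, Finset.sum_add_distrib, Finset.sum_range_sub', Finset.sum_const,
    Finset.card_range, nsmul_eq_mul] at h1
  linarith

section Scheme

variable {f : ℝ → ℝ → ℝ} {k u₀ : ℝ → ℝ} {kMin kMax uMin uMax γ₁ γ₂ lam κ L B dx : ℝ}

/-! ### The scheme -/

theorem step_eq_cellNew (kk v : ℤ → ℝ) (j : ℤ) :
    step f uMin uMax lam kk v j = cellNew f (fluxU f uMin uMax) lam (kk j) (kk (j + 1))
      (v j) (v (j + 1)) (slope v j) (slope v (j + 1)) := rfl

theorem FluxBounds.sol_mem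
    (h : FluxBounds f (fluxU f uMin uMax) kMin kMax uMin uMax γ₁ γ₂ lam κ L B)
    (hk_mem : ∀ᵐ x ∂(volume : Measure ℝ), k x ∈ Icc kMin kMax) (hk_bv : HasBV k)
    (hu_mem : ∀ᵐ x ∂(volume : Measure ℝ), u₀ x ∈ Icc uMin uMax) (hu_bv : HasBV u₀)
    (hdx : 0 < dx) (n : ℕ) : ∀ j, sol f uMin uMax k u₀ lam dx n j ∈ Icc uMin uMax := by
  induction n with
  | zero => exact fun j => hu_bv.cellAvg_mem hu_mem hdx _
  | succ n ih =>
    intro j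
    rw [sol, step_eq_cellNew]
    exact h.cellNew_mem (hk_bv.cellAvg_mem hk_mem hdx _) (hk_bv.cellAvg_mem hk_mem hdx _)
      (admissible_slope ih j) (admissible_slope ih (j + 1))

theorem FluxBounds.nu_bounds
    (h : FluxBounds f (fluxU f uMin uMax) kMin kMax uMin uMax γ₁ γ₂ lam κ L B)
    (hf : FluxHyp f kMin kMax uMin uMax γ₁ γ₂)
    (hk_mem : ∀ᵐ x ∂(volume : Measure ℝ), k x ∈ Icc kMin kMax) (hk_bv : HasBV k)
    (hu_mem : ∀ᵐ x ∂(volume : Measure ℝ), u₀ x ∈ Icc uMin uMax) (hu_bv : HasBV u₀)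
    (hdx : 0 < dx) (n : ℕ) (j : ℤ) :
    0 ≤ nu f uMin uMax k u₀ lam dx n j ∧
      nu f uMin uMax k u₀ lam dx n j * diff (sol f uMin uMax k u₀ lam dx n) j ^ 2
        ≤ γ₂ / 4 * dissipation (sol f uMin uMax k u₀ lam dx n) j := by
  have hmid : ∀ {a b x y : ℝ}, x ∈ Icc a b → y ∈ Icc a b → (x + y) / 2 ∈ Icc a b :=
    fun hx hy => ⟨by linarith [hx.1, hy.1], by linarith [hx.2, hy.2]⟩
  have hk := fun p => hk_bv.cellAvg_mem hk_mem hdx p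
  have hu := h.sol_mem hk_mem hk_bv hu_mem hu_bv hdx n
  have hfuu := hf.fuu_bounds _ (hk ((j : ℝ) + (n : ℝ) / 2 + 1 / 2)) _ (hmid (hu j) (hu (j + 1)))
  exact weight_bounds
    ((h.abs_lam_fu_le (hmid (hk _) (hk _)) (hmid (hu j) (hu (j + 1)))).trans h.kappa_le)
    (hf.gamma_pos.le.trans hfuu.1) hfuu.2

/-- The dissipation over any window of cells is bounded by the number of time steps, uniformly in
the window and in the mesh size. -/
theorem FluxBounds.exists_sum_dissipation_le
    (h : FluxBounds f (fluxU f uMin uMax) kMin kMax uMin uMax γ₁ γ₂ lam κ L B)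
    (hk_mem : ∀ᵐ x ∂(volume : Measure ℝ), k x ∈ Icc kMin kMax) (hk_bv : HasBV k)
    (hu_mem : ∀ᵐ x ∂(volume : Measure ℝ), u₀ x ∈ Icc uMin uMax) (hu_bv : HasBV u₀) :
    ∃ A, 0 ≤ A ∧ ∀ dx, 0 < dx → ∀ (j₀ : ℤ) (M N : ℕ),
      ∑ n ∈ Finset.range N, ∑ i ∈ Finset.range M,
        dissipation (sol f uMin uMax k u₀ lam dx n) (j₀ + i) ≤ N * A := by
  obtain ⟨Λ, hΛ, hcell⟩ := h.exists_cell_energy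
  obtain ⟨BQ, hBQ0, hBQ⟩ := h.exists_entropyFlux_bound
  obtain ⟨RK, hRK0, hRK⟩ := hk_bv.exists_cellAvg_variation
  obtain ⟨RU, hRU0, hRU⟩ := hu_bv.exists_cellAvg_variation
  have hlam := h.lam_pos
  have hB := h.bound_nonneg
  have hD : 0 ≤ uMax - uMin := sub_nonneg.2 h.u_le
  set C := supBound uMin uMax with hCdef
  have hC : 0 ≤ C := (abs_nonneg _).trans (abs_le_supBound (left_mem_Icc.2 h.u_le))
  set BY := C / 2 + (uMax - uMin) / 8 + lam * B with hBY
  refine ⟨20 * (C ^ 2 / 4 + 2 * BQ + Λ * RK + (2 * C * BY + BY * RU)), by positivity,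
    fun dx hdx j₀ M N => ?_⟩
  set fu := fluxU f uMin uMax with hfu
  set v := sol f uMin uMax k u₀ lam dx with hv
  set kk := coeff k dx with hkk
  have hk : ∀ n j, kk n j ∈ Icc kMin kMax := fun n j => hk_bv.cellAvg_mem hk_mem hdx _
  have hu : ∀ n j, v n j ∈ Icc uMin uMax := h.sol_mem hk_mem hk_bv hu_mem hu_bv hdx
  have hadm : ∀ n j, Admissible uMin uMax (v n j) (slope (v n) j) := fun n j =>
    admissible_slope (hu n) j
  have hstep : ∀ n j, v (n + 1) j = cellNew f fu lam (kk n j) (kk n (j + 1))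
      (v n j) (v n (j + 1)) (slope (v n) j) (slope (v n) (j + 1)) := fun n j => rfl
  have hj : ∀ i : ℕ, j₀ + ((i + 1 : ℕ) : ℤ) = j₀ + i + 1 := fun i => by push_cast; ring
  -- With a fixed index window, the physical window drifts by half a cell per step. New value `i` is
  -- compared with old value `i`, its left neighbour, so `Y` contains `v / 2`.
  refine sum_dissipation_le (U := fun n i => v n (j₀ + i)) (K := fun n i => kk n (j₀ + i))
    (Q := fun n i => entropyFlux f fu uMin lam (kk n (j₀ + i)) (v n (j₀ + i))
      (slope (v n) (j₀ + i)))
    (Y := fun n i => v n (j₀ + i) / 2 - slope (v n) (j₀ + i) / 8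
      - lam * f (kk n (j₀ + i)) (midVal fu lam (kk n (j₀ + i)) (v n (j₀ + i))
        (slope (v n) (j₀ + i))))
    (D := fun n i => dissipation (v n) (j₀ + i)) M N hΛ ?_ ?_ ?_ ?_ ?_ ?_ ?_
  · intro n i
    simp only [hj]
    obtain ⟨t, ht0, ht1, ht⟩ := slope_eq_mul_diff (v n) (j₀ + i)
    obtain ⟨s, hs0, hs1, hs⟩ := slope_succ_eq_mul_diff (v n) (j₀ + i)
    have a0 := hadm n (j₀ + i)
    have a1 := hadm n (j₀ + i + 1)
    rw [hstep, dissipation]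
    rw [ht] at a0 ⊢
    rw [hs] at a1 ⊢
    have key := hcell _ (hk n (j₀ + i)) _ (hk n (j₀ + i + 1)) _ _ s t hs0 hs1 ht0 ht1 a0 a1
    rw [diff]
    refine key.trans (le_of_eq ?_)
    ring
  · intro n i
    simp only [hj]
    rw [hstep, cellNew]
    ring
  · exact fun n i => abs_le_supBound (hu n _)
  · exact fun n i => hBQ _ (hk n _) _ _ (hadm n _)
  · intro n i
    have a := hadm n (j₀ + i)
    have m := h.midVal_mem (hk n (j₀ + i)) a.mem a.add_mem a.sub_mem
    refine (abs_sub _ _).trans ((add_le_add_left (abs_sub _ _) _).trans ?_)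
    rw [abs_div, abs_div, abs_mul, abs_of_pos hlam, abs_two,
      abs_of_pos (by norm_num : (0 : ℝ) < 8), hBY]
    gcongr
    · exact abs_le_supBound a.mem
    · exact a.abs_slope_le
    · exact h.bound _ (hk n _) _ m
  · intro n
    simp only [hj]
    exact hRK dx hdx ((n : ℝ) / 2) j₀ M
  · simp only [hj]
    have := hRU dx hdx 0 j₀ M
    simp only [add_zero] at this
    exact this

/-- A nonnegative family over `ℤ` whose sums over windows are bounded. -/
theorem sum_le_of_window_le {F : ℤ → ℝ} {c : ℝ} (h0 : ∀ j, 0 ≤ F j)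
    (h : ∀ (j₀ : ℤ) (M : ℕ), ∑ i ∈ Finset.range M, F (j₀ + i) ≤ c) (S : Finset ℤ) :
    ∑ j ∈ S, F j ≤ c := by
  set J := S.sup Int.natAbs
  have hsub : S ⊆ (Finset.range (2 * J + 1)).image fun i : ℕ => -(J : ℤ) + i := fun j hj => by
    have hjJ : j.natAbs ≤ J := Finset.le_sup (f := Int.natAbs) hj
    rw [Finset.mem_image]
    exact ⟨(j + J).toNat, by rw [Finset.mem_range]; omega, by omega⟩
  refine (Finset.sum_le_sum_of_subset_of_nonneg hsub fun j _ _ => h0 j).trans ?_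
  rw [Finset.sum_image fun a _ b _ hab => by simpa using hab]
  exact h _ _

end Scheme

end NTScheme

end

/-! ### The main theorem. -/

theorem mainTheorem8
    (f : ℝ → ℝ → ℝ) (k u₀ : ℝ → ℝ) (kMin kMax uMin uMax γ₁ γ₂ lam κ : ℝ)
    (hk_le : kMin ≤ kMax) (hu_le : uMin ≤ uMax)
    (hk_mem : ∀ᵐ x ∂(MeasureTheory.volume : MeasureTheory.Measure ℝ), k x ∈ Set.Icc kMin kMax)
    (hk_bv : NTScheme.HasBV k)
    (hf : NTScheme.FluxHyp f kMin kMax uMin uMax γ₁ γ₂)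
    (hu_mem : ∀ᵐ x ∂(MeasureTheory.volume : MeasureTheory.Measure ℝ), u₀ x ∈ Set.Icc uMin uMax)
    (hu_bv : NTScheme.HasBV u₀)
    (hlam : 0 < lam)
    (hcfl : NTScheme.CFL f kMin kMax uMin uMax γ₁ γ₂ lam κ) :
    (∀ dx : ℝ, 0 < dx → ∀ (n : ℕ) (j : ℤ), 0 ≤ NTScheme.nu f uMin uMax k u₀ lam dx n j) ∧
    (∀ T : ℝ, 0 < T → ∀ dxMax : ℝ, 0 < dxMax →
      ∃ K : ℝ, ∀ dx : ℝ, 0 < dx → dx ≤ dxMax →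
        (∀ n : ℕ, Summable fun j : ℤ =>
          NTScheme.nu f uMin uMax k u₀ lam dx n j *
            NTScheme.diff (NTScheme.sol f uMin uMax k u₀ lam dx n) j ^ 2) ∧
        dx * ∑ n ∈ Finset.range (⌊T / (lam * dx)⌋₊ + 1), ∑' j : ℤ,
          NTScheme.nu f uMin uMax k u₀ lam dx n j *
            NTScheme.diff (NTScheme.sol f uMin uMax k u₀ lam dx n) j ^ 2 ≤ K) := by
  obtain ⟨L, B, h⟩ := hf.exists_fluxBounds hk_le hu_le hlam hcfl
  have hν := fun (dx : ℝ) (hdx : 0 < dx) =>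
    h.nu_bounds hf hk_mem hk_bv hu_mem hu_bv hdx
  refine ⟨fun dx hdx n j => (hν dx hdx n j).1, fun T hT dxMax hdxMax => ?_⟩
  obtain ⟨A, hA0, hA⟩ := h.exists_sum_dissipation_le hk_mem hk_bv hu_mem hu_bv
  have hγ₂ : 0 ≤ γ₂ := h.gamma_pos.le.trans h.gamma_le
  -- The first factor bounds `dx * N`: `T / lam` comes from the floor and `dxMax` from the extra
  -- step. The second bounds the weighted dissipation per step.
  refine ⟨(T / lam + dxMax) * (γ₂ / 4 * A), fun dx hdx hdxle => ?_⟩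
  set F : ℕ → ℤ → ℝ := fun n j => NTScheme.nu f uMin uMax k u₀ lam dx n j *
    NTScheme.diff (NTScheme.sol f uMin uMax k u₀ lam dx n) j ^ 2
  have hF0 : ∀ n j, 0 ≤ F n j := fun n j => mul_nonneg (hν dx hdx n j).1 (sq_nonneg _)
  -- A bound over arbitrary finite sets of cells gives both the summability at each level and the
  -- estimate of the total.
  have hbound : ∀ (N : ℕ) (S : Finset ℤ),
      ∑ j ∈ S, ∑ n ∈ Finset.range N, F n j ≤ N * (γ₂ / 4 * A) := fun N S => by
    refine NTScheme.sum_le_of_window_le (F := fun j => ∑ n ∈ Finset.range N, F n j)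
      (fun j => Finset.sum_nonneg fun n _ => hF0 n j) (fun j₀ M => ?_) S
    rw [Finset.sum_comm]
    calc ∑ n ∈ Finset.range N, ∑ i ∈ Finset.range M, F n (j₀ + i)
        ≤ ∑ n ∈ Finset.range N, ∑ i ∈ Finset.range M, γ₂ / 4 *
            NTScheme.dissipation (NTScheme.sol f uMin uMax k u₀ lam dx n) (j₀ + i) :=
          Finset.sum_le_sum fun n _ => Finset.sum_le_sum fun i _ => (hν dx hdx n _).2
      _ = γ₂ / 4 * ∑ n ∈ Finset.range N, ∑ i ∈ Finset.range M,
            NTScheme.dissipation (NTScheme.sol f uMin uMax k u₀ lam dx n) (j₀ + i) := by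
          simp_rw [Finset.mul_sum]
      _ ≤ γ₂ / 4 * (N * A) := by gcongr; exact hA dx hdx j₀ M N
      _ = N * (γ₂ / 4 * A) := by ring
  have hsum : ∀ n, Summable (F n) := fun n =>
    summable_of_sum_le (hF0 n) fun S => (Finset.sum_le_sum fun j _ =>
      Finset.single_le_sum (f := fun m => F m j) (fun m _ => hF0 m j)
        (Finset.self_mem_range_succ n)).trans (hbound (n + 1) S)
  refine ⟨hsum, ?_⟩
  set N := ⌊T / (lam * dx)⌋₊ + 1 with hN
  have htotal : ∑ n ∈ Finset.range N, ∑' j, F n j ≤ N * (γ₂ / 4 * A) := by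
    rw [← Summable.tsum_finsetSum fun n _ => hsum n]
    exact (summable_sum fun n _ => hsum n).tsum_le_of_sum_le (hbound N)
  have hNle : dx * N ≤ T / lam + dxMax := by
    have h1 : (⌊T / (lam * dx)⌋₊ : ℝ) ≤ T / (lam * dx) := Nat.floor_le (by positivity)
    have h2 : dx * (T / (lam * dx)) = T / lam := by field_simp
    have h3 := mul_le_mul_of_nonneg_left h1 hdx.le
    rw [hN]
    push_cast
    linarith
  calc dx * ∑ n ∈ Finset.range N, ∑' j, F n j ≤ dx * (N * (γ₂ / 4 * A)) := by gcongr
    _ = dx * N * (γ₂ / 4 * A) := by ring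
    _ ≤ _ := by gcongr
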